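/- Let $G$ be a group and let $\mathfrak F$ be a family of subgroups of $G$, i.e. a collection of subgroups closed under conjugation and under taking subgroups. Let $\mathcal O_{\mathfrak F}G$ be the orbit category, whose objects are the $G$-sets $G/H$ with $H\in\mathfrak F$ and whose morphisms are the $G$-maps. A Bredon module over $\mathfrak F$ is a contravariant functor from $\mathcal O_{\mathfrak F}G$ to abelian groups. For a Bredon module $M$ put $H^i_{\mathfrak F}(G,M)=\mathrm{Ext}^i(\underline{\mathbb Z},M)$, the Ext group in the category of Bredon modules, where $\underline{\mathbb Z}$ is the constant functor with value $\mathbb Z$. For a subgroup $S\le G$ let $\mathfrak F\cap S=\{H\cap S\mid H\in\mathfrak F\}$, and let $\mathrm{Res}^G_S M$ be the composite of $M$ with the functor $\mathcal O_{\mathfrak F\cap S}S\to\mathcal O_{\mathfrak F}G$, $S/L\mapsto G/L$. Let $X$ be a $G$-tree, i.e. a tree on which $G$ acts by automorphisms without inversions, such that for every $F\in\mathfrak F$ the fixed subgraph $X^F$ is nonempty and connected. Let $\Sigma_0$ and $\Sigma_1$ be sets of representatives of the $G$-orbits of the vertices and of the (unoriented) edges of $X$, and write $G_v$ and $G_e$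 for the stabilizers of a vertex $v$ and of an edge $e$. Then for every Bredon module $M$ over $\mathfrak F$ there is a long exact sequence of abelian groups $$0\to H^0_{\mathfrak F}(G,M)\to\cdots\to H^i_{\mathfrak F}(G,M)\to\prod_{v\in\Sigma_0}H^i_{\mathfrak F\cap G_v}(G_v,\mathrm{Res}^G_{G_v}M)\to\prod_{e\in\Sigma_1}H^i_{\mathfrak F\cap G_e}(G_e,\mathrm{Res}^G_{G_e}M)\to H^{i+1}_{\mathfrak F}(G,M)\to\cdots\qquad(i\ge 0).$$ (When $\Sigma_0$ and $\Sigma_1$ are finite, the products are direct sums.) -/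

import Mathlib

open CategoryTheory

universe u v

/-- A family of subgroups of `G`: a collection of subgroups that is closed under conjugation
and under passing to subgroups. -/
structure SubgroupFamily (G : Type u) [Group G] where
  carrier : Set (Subgroup G)
  conj_mem : ∀ H ∈ carrier, ∀ g : G, H.map (MulAut.conj g).toMonoidHom ∈ carrier
  mem_of_le : ∀ H ∈ carrier, ∀ K : Subgroup G, K ≤ H → K ∈ carrier

namespace SubgroupFamily

variable {G : Type u} [Group G]

instance : Membership (Subgroup G) (SubgroupFamily G) := ⟨fun 𝔉 H => H ∈ 𝔉.carrier⟩

/-- The family `𝔉 ∩ S = {H ∩ S | H ∈ 𝔉}` of subgroups of a subgroup `S` of `G`. -/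
def inter (𝔉 : SubgroupFamily G) (S : Subgroup G) : SubgroupFamily S where
  carrier := {L | ∃ H ∈ 𝔉, L = H.subgroupOf S}
  conj_mem := by
    rintro _ ⟨H, hH, rfl⟩ s
    refine ⟨H.map (MulAut.conj (s : G)).toMonoidHom, 𝔉.conj_mem H hH s, ?_⟩
    ext x
    simp only [Subgroup.mem_map, Subgroup.mem_subgroupOf]
    constructor
    · rintro ⟨y, hy, rfl⟩
      exact ⟨y, hy, by simp⟩
    · rintro ⟨y, hy, hyx⟩
      have hyx' : (s : G) * y * (s : G)⁻¹ = x := by simpa using hyx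
      have hy' : y = ((s⁻¹ * x * s : S) : G) := by
        simp [← hyx', mul_assoc]
      refine ⟨s⁻¹ * x * s, hy' ▸ hy, ?_⟩
      simp [mul_assoc]
  mem_of_le := by
    rintro _ ⟨H, hH, rfl⟩ K hK
    refine ⟨K.map S.subtype, 𝔉.mem_of_le H hH _ ?_, ?_⟩
    · rintro _ ⟨k, hk, rfl⟩
      exact hK hk
    · exact (Subgroup.comap_map_eq_self_of_injective S.subtype_injective K).symm

theorem map_subtype_mem (𝔉 : SubgroupFamily G) (S : Subgroup G) {L : Subgroup S}
    (hL : L ∈ 𝔉.inter S) : L.map S.subtype ∈ 𝔉 := by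
  obtain ⟨H, hH, rfl⟩ := hL
  refine 𝔉.mem_of_le H hH _ ?_
  rintro _ ⟨k, hk, rfl⟩
  exact hk

end SubgroupFamily

/-- The orbit category of `G` over the family `𝔉`. The object `⟨H, _⟩` stands for the
transitive `G`-set `G ⧸ H`. -/
structure OrbitCat {G : Type u} [Group G] (𝔉 : SubgroupFamily G) : Type u where
  grp : Subgroup G
  mem : grp ∈ 𝔉

namespace OrbitCat

variable {G : Type u} [Group G]

/-- The morphisms from `G ⧸ H` to `G ⧸ K` are the `G`-equivariant maps. -/
instance category (𝔉 : SubgroupFamily G) : Category.{u} (OrbitCat 𝔉) where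
  Hom A B := (G ⧸ A.grp) →[G] (G ⧸ B.grp)
  id A := MulActionHom.id G
  comp f g := MulActionHom.comp g f

/-- The map `S ⧸ L → G ⧸ L` induced by the inclusion of `S` in `G`. -/
def cosetMap {S : Subgroup G} (L : Subgroup S) : S ⧸ L → G ⧸ L.map S.subtype :=
  Quotient.map' (fun s : S => (s : G)) (by
    intro a b hab
    rw [QuotientGroup.leftRel_apply] at hab ⊢
    exact ⟨a⁻¹ * b, hab, by simp⟩)

theorem cosetMap_smul {S : Subgroup G} (L : Subgroup S) (s : S) (x : S ⧸ L) :
    cosetMap L (s • x) = (s : G) • cosetMap L x := by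
  induction x using QuotientGroup.induction_on with
  | H t => rfl

/-- The `G`-map `G ⧸ L → G ⧸ K`, `g L ↦ g x K`, that belongs to the `S`-map
`f : S ⧸ L → S ⧸ K` with `f (L) = x K`. -/
def inducedMap {S : Subgroup G} {L K : Subgroup S} (f : (S ⧸ L) →[S] (S ⧸ K)) :
    (G ⧸ L.map S.subtype) →[G] (G ⧸ K.map S.subtype) where
  toFun := Quotient.lift (fun g : G => g • cosetMap K (f (QuotientGroup.mk (1 : S)))) (by
    intro a b hab
    have hab' : a⁻¹ * b ∈ L.map S.subtype := QuotientGroup.leftRel_apply.mp hab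
    obtain ⟨l, hl, hl'⟩ := hab'
    have hb : b = a * (l : G) := by
      have h : (l : G) = a⁻¹ * b := hl'
      rw [h, mul_inv_cancel_left]
    have hfix : (l • (QuotientGroup.mk (1 : S) : S ⧸ L)) = QuotientGroup.mk (1 : S) := by
      refine QuotientGroup.eq.mpr ?_
      simpa using hl
    change a • _ = b • _
    rw [hb, mul_smul, ← cosetMap_smul, ← map_smul f, hfix])
  map_smul' := by
    intro g x
    induction x using QuotientGroup.induction_on with
    | H t => exact mul_smul g t _

theorem inducedMap_cosetMap {S : Subgroup G} {L K : Subgroup S} (f : (S ⧸ L) →[S] (S ⧸ K))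
    (x : S ⧸ L) : inducedMap f (cosetMap L x) = cosetMap K (f x) := by
  induction x using QuotientGroup.induction_on with
  | H t =>
    change (t : G) • cosetMap K (f (QuotientGroup.mk (1 : S))) = _
    rw [← cosetMap_smul, ← map_smul f]
    congr 2
    exact congrArg QuotientGroup.mk (mul_one t)

/-- The inclusion functor from the orbit category of `S` over `𝔉 ∩ S` to the orbit category
of `G` over `𝔉`, sending `S ⧸ L` to `G ⧸ L`. -/
def inclusion (𝔉 : SubgroupFamily G) (S : Subgroup G) : OrbitCat (𝔉.inter S) ⥤ OrbitCat 𝔉 where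
  obj A := ⟨A.grp.map S.subtype, 𝔉.map_subtype_mem S A.mem⟩
  map {A B} f := inducedMap (S := S) (L := A.grp) (K := B.grp) f
  map_id A := by
    refine MulActionHom.ext fun x => ?_
    induction x using QuotientGroup.induction_on with
    | H t => exact congrArg QuotientGroup.mk (mul_one t)
  map_comp {A B C} f g := by
    refine MulActionHom.ext fun x => ?_
    induction x using QuotientGroup.induction_on with
    | H t =>
      exact ((map_smul (inducedMap (S := S) (L := B.grp) (K := C.grp) g) t _).trans
        (congrArg (t • ·) (inducedMap_cosetMap (L := B.grp) (K := C.grp) g _))).symm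

end OrbitCat

/-- The category of (right) Bredon modules over the family `𝔉`: contravariant functors from
the orbit category to abelian groups. -/
abbrev BredonMod {G : Type u} [Group G] (𝔉 : SubgroupFamily G) : Type (u + 1) :=
  (OrbitCat 𝔉)ᵒᵖ ⥤ AddCommGrpCat.{u}

namespace BredonMod

variable {G : Type u} [Group G]

/-- The trivial Bredon module: the constant functor with value `ℤ`. -/
def trivial (𝔉 : SubgroupFamily G) : BredonMod 𝔉 :=
  (Functor.const _).obj (AddCommGrpCat.of (ULift.{u} ℤ))

/-- Restriction of Bredon modules to a subgroup `S`. -/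
def res {𝔉 : SubgroupFamily G} (S : Subgroup G) (M : BredonMod 𝔉) : BredonMod (𝔉.inter S) :=
  (OrbitCat.inclusion 𝔉 S).op ⋙ M

instance hasExt (𝔉 : SubgroupFamily G) : HasExt.{u} (BredonMod 𝔉) :=
  haveI : HasSeparator (BredonMod 𝔉) := Presheaf.hasSeparator.{u} _ _
  haveI : IsGrothendieckAbelian.{u} (BredonMod 𝔉) :=
    { ab5OfSize := ⟨fun _ _ _ => inferInstance⟩ }
  inferInstance

end BredonMod

/-- The `n`-th Bredon cohomology group `H^n_𝔉(G, M) = Ext^n(ℤ, M)`, where `Ext` is taken in the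
category of Bredon modules over `𝔉`. -/
abbrev BredonCohomology {G : Type u} [Group G] (𝔉 : SubgroupFamily G) (M : BredonMod 𝔉)
    (n : ℕ) : Type u :=
  Abelian.Ext.{u} (BredonMod.trivial 𝔉) M n

/-- A `G`-tree: a tree on whose vertices `G` acts by graph automorphisms, without inversions. -/
structure IsGTree (G : Type u) [Group G] {V : Type v} [MulAction G V] (X : SimpleGraph V) :
    Prop where
  isTree : X.IsTree
  smul_adj : ∀ (g : G) (a b : V), X.Adj a b → X.Adj (g • a) (g • b)
  no_inversion : ∀ (g : G) (a b : V), X.Adj a b → ¬ (g • a = b ∧ g • b = a)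

/-- The fixed subgraph `X^F`: its vertices are those fixed by `F`, and its edges are the edges of
`X` both of whose ends are fixed by `F`. -/
abbrev fixedSubgraph {G : Type u} [Group G] {V : Type v} [MulAction G V] (X : SimpleGraph V)
    (F : Subgroup G) : SimpleGraph (MulAction.fixedPoints F V) :=
  X.induce (MulAction.fixedPoints F V)

/-- The action of `G` on unordered pairs of vertices; an edge `s(a, b)` goes to `s(g a, g b)`. -/
instance sym2MulAction (G : Type u) [Group G] (V : Type v) [MulAction G V] :
    MulAction G (Sym2 V) where
  smul g e := e.map (g • ·)
  one_smul e := by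
    induction e using Sym2.ind with
    | _ a b => change s((1 : G) • a, (1 : G) • b) = _; simp
  mul_smul g h e := by
    induction e using Sym2.ind with
    | _ a b => change s((g * h) • a, (g * h) • b) = s(g • h • a, g • h • b); simp [mul_smul]

/-- `T` is a set of representatives of the `G`-orbits of the elements of `A`. -/
def IsOrbitReps (G : Type u) [Group G] {α : Type v} [MulAction G α] (A T : Set α) : Prop :=
  T ⊆ A ∧ ∀ a ∈ A, ∃! t, t ∈ T ∧ t ∈ MulAction.orbit G a

/-! For a `G`-set `W`, let `ℤ[W^?]` be the Bredon module with value `ℤ[W^A]` at `G ⧸ A`. Each `X^F`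
with `F ∈ 𝔉` is a nonempty connected subgraph of a tree, hence a tree. Since there are no
inversions, the edge set `E` can be oriented equivariantly, and `0 → ℤ[E^?] → ℤ[V^?] → ℤ → 0` is
exact. Applying `Hom(-, I)` for an injective resolution `I` of `M` gives a short exact sequence of
cochain complexes, whose long exact sequence is the claim.

Two facts identify the terms. `Hom(ℤ[W^?], M)` splits over the orbits of `W` as a product of groups
`Hom(ℤ, Res M)` over stabilizers (`exists_section`, `sectionsEquiv`). Restriction to a stabilizer is
exact and preserves injectives (`preservesInjectiveObjects_resFunctor`), so the restricted
resolution computes the cohomology of the stabilizer. Both rest on `exists_initial_factorization`.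

The modules `ℤ[W^?]` are never formed; `equivariantSections` plays the role of `Hom(ℤ[W^?], M)`.
Exactness at the first two terms holds for every `M` (`constSections_injective`,
`exists_constSections_eq`). Surjectivity onto the edge term (`coboundary_surjective`) reduces to
coinduced modules, where it says that the trees `X^H` have vanishing first cohomology. -/

/-- Additive maps descend along a surjection whose kernel is killed. -/
theorem AddMonoidHom.exists_factor_of_surjective {Z H K : Type*} [AddCommGroup Z] [AddCommGroup H]
    [AddCommGroup K] (q : Z →+ H) (hq : Function.Surjective q) (f : Z →+ K)
    (hf : ∀ z, q z = 0 → f z = 0) : ∃ g : H →+ K, ∀ z, g (q z) = f z := by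
  refine ⟨AddMonoidHom.liftOfSurjective q hq ⟨f, fun z hz => hf z hz⟩, fun z => ?_⟩
  exact AddMonoidHom.liftOfRightInverse_comp_apply q _ _ ⟨f, fun z hz => hf z hz⟩ z

/-! ### Cohomology of cochain complexes of abelian groups and the long exact sequence. -/

/-- A presentation of the cohomology `H` of a cochain complex `(A, d)` of abelian groups: an
additive map from the cocycles onto `H` whose kernel consists of the coboundaries. -/
structure CohomologyPresentation (A : ℕ → Type*) [∀ n, AddCommGroup (A n)]
    (d : ∀ n, A n →+ A (n + 1)) (H : ℕ → Type*) [∀ n, AddCommGroup (H n)] where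
  /-- The class of a cocycle. -/
  cls : ∀ n, (d n).ker →+ H n
  surjective : ∀ n, Function.Surjective (cls n)
  eq_zero_of_cls_zero : ∀ z, cls 0 z = 0 → z = 0
  cls_succ_eq_zero_iff : ∀ n z, cls (n + 1) z = 0 ↔ ∃ y, d n y = z

namespace CohomologyPresentation

section pi

variable {ι : Type*} {A : ι → ℕ → Type*} [∀ j n, AddCommGroup (A j n)]
  {d : ∀ j n, A j n →+ A j (n + 1)} {H : ι → ℕ → Type*} [∀ j n, AddCommGroup (H j n)]

/-- The product of the differentials of a family of cochain complexes. -/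
def piDifferential (d : ∀ j n, A j n →+ A j (n + 1)) (n : ℕ) :
    (∀ j, A j n) →+ ∀ j, A j (n + 1) :=
  AddMonoidHom.mk' (fun x j => d j n (x j)) (fun x y => by funext j; simp)

/-- Products of abelian groups are exact, so cohomology commutes with products. -/
def pi (P : ∀ j, CohomologyPresentation (A j) (d j) (H j)) :
    CohomologyPresentation (fun n => ∀ j, A j n) (piDifferential d) (fun n => ∀ j, H j n) where
  cls n := AddMonoidHom.mk' (fun z j => (P j).cls n ⟨z.1 j, congrFun z.2 j⟩) (fun x y => by
    funext j
    exact map_add ((P j).cls n) ⟨x.1 j, congrFun x.2 j⟩ ⟨y.1 j, congrFun y.2 j⟩)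
  surjective n h := by
    choose z hz using fun j => (P j).surjective n (h j)
    exact ⟨⟨fun j => (z j).1, funext fun j => (z j).2⟩, funext hz⟩
  eq_zero_of_cls_zero z hz := by
    refine Subtype.ext (funext fun j => ?_)
    exact congrArg Subtype.val ((P j).eq_zero_of_cls_zero _ (congrFun hz j))
  cls_succ_eq_zero_iff n z := by
    constructor
    · intro hz
      choose y hy using fun j => ((P j).cls_succ_eq_zero_iff n _).1 (congrFun hz j)
      exact ⟨y, funext hy⟩
    · rintro ⟨y, hy⟩
      exact funext fun j => ((P j).cls_succ_eq_zero_iff n _).2 ⟨y j, congrFun hy j⟩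

end pi

section exact

variable {A B C : ℕ → Type*} [∀ n, AddCommGroup (A n)] [∀ n, AddCommGroup (B n)]
  [∀ n, AddCommGroup (C n)]
  {dA : ∀ n, A n →+ A (n + 1)} {dB : ∀ n, B n →+ B (n + 1)} {dC : ∀ n, C n →+ C (n + 1)}
  {HA HB HC : ℕ → Type*} [∀ n, AddCommGroup (HA n)] [∀ n, AddCommGroup (HB n)]
  [∀ n, AddCommGroup (HC n)]

theorem exists_map (PA : CohomologyPresentation A dA HA) (PB : CohomologyPresentation B dB HB)
    (i : ∀ n, A n →+ B n) (hi : ∀ n a, dB n (i n a) = i (n + 1) (dA n a)) (n : ℕ) :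
    ∃ α : HA n →+ HB n, ∀ (z : (dA n).ker) (h : dB n (i n z) = 0),
      α (PA.cls n z) = PB.cls n ⟨i n z, h⟩ := by
  have hk : ∀ z : (dA n).ker, dB n (i n z) = 0 := fun z => by
    rw [hi, z.2, map_zero]
  obtain ⟨α, hα⟩ := AddMonoidHom.exists_factor_of_surjective (PA.cls n) (PA.surjective n)
    ((PB.cls n).comp (AddMonoidHom.mk' (fun z : (dA n).ker => (⟨i n z, hk z⟩ : (dB n).ker))
      (fun x y => Subtype.ext (map_add (i n) x.1 y.1)))) (by
      intro z hz
      change PB.cls n ⟨i n z, hk z⟩ = 0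
      cases n with
      | zero =>
        have h0 := PA.eq_zero_of_cls_zero z hz
        subst h0
        convert map_zero (PB.cls 0)
        simp
      | succ n =>
        obtain ⟨y, hy⟩ := (PA.cls_succ_eq_zero_iff n z).1 hz
        exact (PB.cls_succ_eq_zero_iff n _).2 ⟨i n y, by rw [hi, hy]⟩)
  exact ⟨α, fun z _ => hα z⟩

/-- The connecting homomorphism of a short exact sequence of cochain complexes. -/
theorem exists_connecting (PA : CohomologyPresentation A dA HA)
    (PC : CohomologyPresentation C dC HC)
    (hdB : ∀ n b, dB (n + 1) (dB n b) = 0)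
    (i : ∀ n, A n →+ B n) (hi : ∀ n a, dB n (i n a) = i (n + 1) (dA n a))
    (p : ∀ n, B n →+ C n) (hp : ∀ n b, dC n (p n b) = p (n + 1) (dB n b))
    (hinj : ∀ n, Function.Injective (i n)) (hex : ∀ n, Function.Exact (i n) (p n))
    (hsurj : ∀ n, Function.Surjective (p n)) (n : ℕ) :
    ∃ δ : HC n →+ HA (n + 1), ∀ (z : (dC n).ker) (a : (dA (n + 1)).ker) (b : B n),
      p n b = z → i (n + 1) a = dB n b → δ (PC.cls n z) = PA.cls (n + 1) a := by
  have hlift : ∀ z : (dC n).ker, ∃ (a : (dA (n + 1)).ker) (b : B n),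
      p n b = z ∧ i (n + 1) a = dB n b := by
    intro z
    obtain ⟨b, hb⟩ := hsurj n z
    obtain ⟨a, ha⟩ := (hex (n + 1) (dB n b)).1 (by rw [← hp, hb, z.2])
    refine ⟨⟨a, hinj (n + 2) ?_⟩, b, hb, ha⟩
    rw [← hi, ha, hdB, map_zero]
  -- Independence of all choices; additivity of the connecting map and its vanishing on coboundaries
  -- are both instances of it.
  have hwd : ∀ (a a' : (dA (n + 1)).ker) (b b' : B n), p n b = p n b' →
      i (n + 1) a = dB n b → i (n + 1) a' = dB n b' → PA.cls (n + 1) a = PA.cls (n + 1) a' := by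
    intro a a' b b' hbb ha ha'
    obtain ⟨y, hy⟩ := (hex n (b - b')).1 (by rw [map_sub, hbb, sub_self])
    rw [← sub_eq_zero, ← map_sub, PA.cls_succ_eq_zero_iff]
    refine ⟨y, hinj (n + 1) ?_⟩
    rw [← hi, hy, map_sub, ← ha, ← ha', ← map_sub]
    rfl
  choose a b hb hab using hlift
  obtain ⟨δ, hδ⟩ := AddMonoidHom.exists_factor_of_surjective (PC.cls n) (PC.surjective n)
    (AddMonoidHom.mk' (fun z => PA.cls (n + 1) (a z)) (fun x y => by
      rw [← map_add]
      refine hwd _ _ (b (x + y)) (b x + b y) ?_ (hab _) ?_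
      · rw [hb, map_add, hb, hb]; rfl
      · rw [map_add, ← hab, ← hab, ← map_add]; rfl)) (by
      intro z hz
      change PA.cls (n + 1) (a z) = 0
      cases n with
      | zero =>
        have h0 := PC.eq_zero_of_cls_zero z hz
        rw [← map_zero (PA.cls 1)]
        refine hwd _ _ (b z) 0 ?_ (hab _) ?_
        · rw [hb, h0, map_zero]; rfl
        · simp
      | succ n =>
        obtain ⟨y, hy⟩ := (PC.cls_succ_eq_zero_iff n z).1 hz
        obtain ⟨x, hx⟩ := hsurj n y
        rw [← map_zero (PA.cls (n + 2))]
        refine hwd _ _ (b z) (dB n x) ?_ (hab _) ?_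
        · rw [hb, ← hp, hx, hy]
        · simp [hdB])
  refine ⟨δ, fun z a' b' hb' ha' => ?_⟩
  rw [hδ]
  exact hwd _ _ (b z) b' (by rw [hb, hb']) (hab z) ha'

/-- The long exact sequence of a short exact sequence of cochain complexes of abelian groups, which
may live in different universes. -/
theorem exists_long_exact (PA : CohomologyPresentation A dA HA)
    (PB : CohomologyPresentation B dB HB) (PC : CohomologyPresentation C dC HC)
    (hdB : ∀ n b, dB (n + 1) (dB n b) = 0)
    (i : ∀ n, A n →+ B n) (hi : ∀ n a, dB n (i n a) = i (n + 1) (dA n a))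
    (p : ∀ n, B n →+ C n) (hp : ∀ n b, dC n (p n b) = p (n + 1) (dB n b))
    (hinj : ∀ n, Function.Injective (i n)) (hex : ∀ n, Function.Exact (i n) (p n))
    (hsurj : ∀ n, Function.Surjective (p n)) :
    ∃ (α : ∀ n, HA n →+ HB n) (β : ∀ n, HB n →+ HC n) (δ : ∀ n, HC n →+ HA (n + 1)),
      Function.Injective (α 0) ∧
      ∀ n, Function.Exact (α n) (β n) ∧ Function.Exact (β n) (δ n) ∧
        Function.Exact (δ n) (α (n + 1)) := by
  choose α hα using exists_map PA PB i hi
  choose β hβ using exists_map PB PC p hp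
  choose δ hδ using exists_connecting PA PC hdB i hi p hp hinj hex hsurj
  have hiZ : ∀ n (z : (dA n).ker), dB n (i n z) = 0 := fun n z => by rw [hi, z.2, map_zero]
  have hpZ : ∀ n (z : (dB n).ker), dC n (p n z) = 0 := fun n z => by rw [hp, z.2, map_zero]
  have hpi : ∀ n a, p n (i n a) = 0 := fun n a => (hex n _).2 ⟨a, rfl⟩
  refine ⟨α, β, δ, ?_, fun n => ⟨fun y => ⟨?_, ?_⟩, fun y => ⟨?_, ?_⟩, fun y => ⟨?_, ?_⟩⟩⟩
  · rw [injective_iff_map_eq_zero]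
    intro x hx
    obtain ⟨z, rfl⟩ := PA.surjective 0 x
    rw [hα 0 z (hiZ 0 z)] at hx
    have h0 := congrArg Subtype.val (PB.eq_zero_of_cls_zero _ hx)
    have : z = 0 := Subtype.ext (hinj 0 (h0.trans (map_zero _).symm))
    rw [this, map_zero]
  · intro hy
    obtain ⟨z, rfl⟩ := PB.surjective n y
    rw [hβ n z (hpZ n z)] at hy
    -- Change the cocycle within its class so that its image in `C` is zero and not merely a
    -- coboundary. In degree 0 there are no coboundaries and nothing to change.
    obtain ⟨b, hb, hbz⟩ : ∃ b : (dB n).ker, PB.cls n b = PB.cls n z ∧ p n b = 0 := by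
      cases n with
      | zero => exact ⟨z, rfl, congrArg Subtype.val (PC.eq_zero_of_cls_zero _ hy)⟩
      | succ n =>
        obtain ⟨c, hc⟩ := (PC.cls_succ_eq_zero_iff n _).1 hy
        obtain ⟨b, rfl⟩ := hsurj n c
        refine ⟨z - ⟨dB n b, hdB n b⟩, ?_, ?_⟩
        · rw [map_sub, sub_eq_self]
          exact (PB.cls_succ_eq_zero_iff n _).2 ⟨b, rfl⟩
        · change p (n + 1) (z.1 - dB n b) = 0
          rw [map_sub, ← hp, hc, sub_self]
    obtain ⟨a, ha⟩ := (hex n b).1 hbz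
    have hda : dA n a = 0 := hinj (n + 1) (by rw [← hi, ha, b.2, map_zero])
    refine ⟨PA.cls n ⟨a, hda⟩, ?_⟩
    rw [hα n _ (hiZ n _), ← hb]
    exact congrArg (PB.cls n) (Subtype.ext ha)
  · rintro ⟨x, rfl⟩
    obtain ⟨z, rfl⟩ := PA.surjective n x
    rw [hα n z (hiZ n z), hβ n _ (hpZ n _), ← map_zero (PC.cls n)]
    exact congrArg (PC.cls n) (Subtype.ext (hpi n z))
  · intro hy
    obtain ⟨z, rfl⟩ := PC.surjective n y
    obtain ⟨b, hb⟩ := hsurj n z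
    obtain ⟨a, ha⟩ := (hex (n + 1) (dB n b)).1 (by rw [← hp, hb, z.2])
    have hda : dA (n + 1) a = 0 := hinj (n + 2) (by rw [← hi, ha, hdB, map_zero])
    rw [hδ n z ⟨a, hda⟩ b hb ha] at hy
    obtain ⟨x, hx⟩ := (PA.cls_succ_eq_zero_iff n _).1 hy
    have hbx : dB n (b - i n x) = 0 := by
      rw [map_sub, hi, hx, ← ha, sub_self]
    refine ⟨PB.cls n ⟨b - i n x, hbx⟩, ?_⟩
    rw [hβ n _ (hpZ n _)]
    refine congrArg (PC.cls n) (Subtype.ext ?_)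
    change p n (b - i n x) = z
    rw [map_sub, hpi, sub_zero, hb]
  · rintro ⟨x, rfl⟩
    obtain ⟨z, rfl⟩ := PB.surjective n x
    rw [hβ n z (hpZ n z), hδ n _ 0 z rfl (by rw [z.2]; exact map_zero _), map_zero]
  · intro hy
    obtain ⟨z, rfl⟩ := PA.surjective (n + 1) y
    rw [hα (n + 1) z (hiZ _ z)] at hy
    obtain ⟨b, hb⟩ := (PB.cls_succ_eq_zero_iff n _).1 hy
    have hpb : dC n (p n b) = 0 := by rw [hp, hb, hpi]
    exact ⟨PC.cls n ⟨p n b, hpb⟩, hδ n _ z b rfl hb.symm⟩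
  · rintro ⟨x, rfl⟩
    obtain ⟨z, rfl⟩ := PC.surjective n x
    obtain ⟨b, hb⟩ := hsurj n z
    obtain ⟨a, ha⟩ := (hex (n + 1) (dB n b)).1 (by rw [← hp, hb, z.2])
    have hda : dA (n + 1) a = 0 := hinj (n + 2) (by rw [← hi, ha, hdB, map_zero])
    rw [hδ n z ⟨a, hda⟩ b hb ha, hα (n + 1) _ (hiZ _ _), PB.cls_succ_eq_zero_iff]
    exact ⟨b, ha.symm⟩

end exact

end CohomologyPresentation

/-! ### `Ext` computed by an injective resolution. -/

namespace CategoryTheory.InjectiveResolution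

open CochainComplex HomComplex Abelian

variable {C : Type*} [Category* C] [Abelian C] [HasExt.{u} C]

/-- A vanishing class is a coboundary from degree `-1`, where the resolution is zero. -/
theorem eq_zero_of_extMk_eq_zero {X Y : C} (R : InjectiveResolution Y)
    (f : X ⟶ R.cocomplex.X 0) (hf : f ≫ R.cocomplex.d 0 1 = 0)
    (h : R.extMk f 1 rfl hf = 0) : f = 0 := by
  rw [← R.extEquivCohomologyClass.apply_eq_iff_eq] at h
  simp only [extEquivCohomologyClass_extMk, extEquivCohomologyClass_zero,
    CohomologyClass.mk_eq_zero_iff] at h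
  rw [Cocycle.fromSingleMk_mem_coboundaries_iff _ _ _ _ _ (-1) (by lia)] at h
  obtain ⟨g, hg⟩ := h
  have hz : Limits.IsZero (R.cochainComplex.X (-1)) :=
    R.cochainComplex.isZero_of_isStrictlyGE 0 (-1) (by lia)
  rw [hz.eq_of_tgt g 0, Limits.zero_comp] at hg
  exact (cancel_mono (R.cochainComplexXIso 0 0 rfl).inv).1 (hg.symm.trans Limits.zero_comp.symm)

/-- An exact functor that preserves injective objects maps injective resolutions to injective
resolutions. -/
noncomputable def map {C D : Type*} [Category* C] [Category* D] [Abelian C]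
    [Abelian D] (F : C ⥤ D) [F.Additive] [F.PreservesInjectiveObjects] [F.PreservesHomology]
    {Z : C} (R : InjectiveResolution Z) :
    InjectiveResolution (F.obj Z) where
  cocomplex := (F.mapHomologicalComplex _).obj R.cocomplex
  injective n := F.injective_obj_of_injective (R.injective n)
  ι := (HomologicalComplex.singleMapHomologicalComplex _ _ _).inv.app _ ≫
    (F.mapHomologicalComplex _).map R.ι
  quasiIso := inferInstance

/-- `Ext X Y` is the cohomology of the complex of homomorphisms from `X` to an injective resolution
of `Y`. -/
noncomputable def extPresentation (X : C) {Y : C} (R : InjectiveResolution Y) :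
    CohomologyPresentation (fun n => X ⟶ R.cocomplex.X n)
      (fun n => Preadditive.rightComp X (R.cocomplex.d n (n + 1)))
      (fun n => Abelian.Ext.{u} X Y n) where
  cls n := AddMonoidHom.mk' (fun f => R.extMk f.1 (n + 1) rfl f.2)
    (fun f g => (R.add_extMk _ _ _ _ f.2 g.2).symm)
  surjective n α := by
    obtain ⟨f, hf, rfl⟩ := R.extMk_surjective α (n + 1) rfl
    exact ⟨⟨f, hf⟩, rfl⟩
  eq_zero_of_cls_zero z hz := Subtype.ext (R.eq_zero_of_extMk_eq_zero _ z.2 hz)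
  cls_succ_eq_zero_iff n z := R.extMk_eq_zero_iff z.1 (n + 2) rfl z.2 n rfl

end CategoryTheory.InjectiveResolution

/-! ### Vanishing of the first cohomology of a tree. -/

namespace SimpleGraph

/-- The signed sum of a 1-cochain along a walk. -/
def Walk.cochainSum {V D : Type*} [AddCommGroup D] {X : SimpleGraph V} (ω : V → V → D) :
    ∀ {a b : V}, X.Walk a b → D
  | _, _, .nil => 0
  | a, _, .cons (v := b) _ p => ω a b + p.cochainSum ω

theorem Walk.cochainSum_concat {V D : Type*} [AddCommGroup D] {X : SimpleGraph V}
    (ω : V → V → D) {a b c : V} (p : X.Walk a b) (h : X.Adj b c) :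
    (p.concat h).cochainSum ω = p.cochainSum ω + ω b c := by
  induction p with
  | nil => simp [Walk.concat, Walk.cochainSum]
  | cons h' p ih => simp only [Walk.concat_cons, Walk.cochainSum, ih]; abel

/-- A tree has trivial first cohomology: each antisymmetric 1-cochain is a coboundary. -/
theorem IsTree.exists_potential {V D : Type*} [AddCommGroup D] {X : SimpleGraph V}
    (hX : X.IsTree) (ω : V → V → D) (hω : ∀ a b, X.Adj a b → ω b a = - ω a b) :
    ∃ f : V → D, ∀ a b, X.Adj a b → f b - f a = ω a b := by
  classical
  obtain ⟨r⟩ := hX.connected.nonempty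
  -- The potential at `w` is the sum of `ω` along the unique path from a root `r` to `w`.
  choose P hP hPu using fun w => hX.existsUnique_path r w
  have key : ∀ a b (h : X.Adj a b), b ∉ (P a).support →
      (P b).cochainSum ω - (P a).cochainSum ω = ω a b := by
    intro a b h hb
    rw [← hPu b ((P a).concat h) ((hP a).concat hb h), Walk.cochainSum_concat]
    abel
  refine ⟨fun w => (P w).cochainSum ω, fun a b h => ?_⟩
  -- For adjacent vertices, the path from the root to one of them extends the path to the other by
  -- the edge between them.
  by_cases hb : b ∈ (P a).support
  · have ha : a ∉ (P b).support := by
      have := hX.isAcyclic.ne_mem_support_of_support_of_adj_of_isPath (hP a) (hP b) h hb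
      exact this
    have := key b a h.symm ha
    rw [hω a b h] at this
    rw [← neg_sub, this, neg_neg]
  · exact key a b h hb

/-- A variant of `exists_potential` with an orientation of the edges. -/
theorem IsTree.exists_potential_of_orientation {V D : Type*} [AddCommGroup D] {X : SimpleGraph V}
    (hX : X.IsTree) (O : V → V → Prop) (hO : ∀ a b, X.Adj a b → (O b a ↔ ¬ O a b))
    (c : V → V → D) (hc : ∀ a b, c a b = c b a) :
    ∃ f : V → D, ∀ a b, X.Adj a b → O a b → f b - f a = c a b := by
  classical
  obtain ⟨f, hf⟩ := hX.exists_potential (fun a b => if O a b then c a b else - c a b) (by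
    intro a b h
    by_cases hab : O a b
    · have : ¬ O b a := fun h' => (hO a b h).1 h' hab
      simp [hab, this, hc a b]
    · have : O b a := (hO a b h).2 hab
      simp [hab, this, hc a b])
  exact ⟨f, fun a b h hab => by rw [hf a b h, if_pos hab]⟩

end SimpleGraph

/-! ### Maps from orbits `G ⧸ H` to a `G`-set, and their factorizations. -/

/-- The `G`-map `G ⧸ H → W`, `g H ↦ g w`, that belongs to a point `w` fixed by `H`. -/
def orbitMap {G : Type u} [Group G] {W : Type v} [MulAction G W] (H : Subgroup G) (w : W)
    (h : ∀ x ∈ H, x • w = w) : (G ⧸ H) →[G] W where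
  toFun := Quotient.lift (fun g : G => g • w) (by
    intro a b hab
    have hab' : a⁻¹ * b ∈ H := QuotientGroup.leftRel_apply.mp hab
    have := h _ hab'
    rw [mul_smul, inv_smul_eq_iff] at this
    exact this.symm)
  map_smul' := by
    intro g x
    induction x using QuotientGroup.induction_on with
    | H t => exact mul_smul g t w

theorem map_mk_eq_smul {G : Type u} [Group G] {W : Type v} [MulAction G W] {H : Subgroup G}
    (φ : (G ⧸ H) →[G] W) (g : G) :
    φ (QuotientGroup.mk g) = g • φ (QuotientGroup.mk (1 : G)) := by
  rw [← map_smul]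
  exact congrArg φ (congrArg QuotientGroup.mk (mul_one g).symm)

theorem smul_map_one {G : Type u} [Group G] {W : Type v} [MulAction G W] {H : Subgroup G}
    (φ : (G ⧸ H) →[G] W) (x : G) (hx : x ∈ H) :
    x • φ (QuotientGroup.mk (1 : G)) = φ (QuotientGroup.mk (1 : G)) := by
  rw [← map_mk_eq_smul]
  refine congrArg φ (QuotientGroup.eq.mpr ?_)
  simpa using hx

theorem orbitHom_ext {G : Type u} [Group G] {W : Type v} [MulAction G W] {H : Subgroup G}
    {φ ψ : (G ⧸ H) →[G] W}
    (h : φ (QuotientGroup.mk (1 : G)) = ψ (QuotientGroup.mk (1 : G))) : φ = ψ := by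
  refine MulActionHom.ext fun x => ?_
  induction x using QuotientGroup.induction_on with
  | H t => exact (map_mk_eq_smul φ t).trans ((congrArg (t • ·) h).trans (map_mk_eq_smul ψ t).symm)

namespace OrbitCat

variable {G : Type u} [Group G] {𝔉 : SubgroupFamily G} {W : Type v} [MulAction G W]

/-- The underlying `G`-map of a morphism of the orbit category. -/
abbrev toMap {A B : OrbitCat 𝔉} (f : A ⟶ B) : (G ⧸ A.grp) →[G] (G ⧸ B.grp) := f

/-- The `G`-map `G ⧸ L → W` given by a point `w` that is fixed by `S ≥ L`. -/
def proj {S : Subgroup G} (w : W) (hw : ∀ s ∈ S, s • w = w) (L : OrbitCat (𝔉.inter S)) :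
    (G ⧸ ((inclusion 𝔉 S).obj L).grp) →[G] W :=
  orbitMap _ w (by
    rintro _ ⟨s, -, rfl⟩
    exact hw _ s.2)

/-- The base coset of `S ⧸ L` goes to a coset of some `s ∈ S`, and `s` fixes `w`. -/
theorem proj_comp {S : Subgroup G} (w : W) (hw : ∀ s ∈ S, s • w = w)
    {L L' : OrbitCat (𝔉.inter S)} (t : L ⟶ L') :
    (proj w hw L').comp (toMap ((inclusion 𝔉 S).map t)) = proj w hw L := by
  refine orbitHom_ext ?_
  change proj w hw L' ((1 : G) • cosetMap L'.grp (toMap t (QuotientGroup.mk (1 : S)))) = (1 : G) • w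
  rw [one_smul, one_smul]
  generalize toMap t (QuotientGroup.mk (1 : S)) = x
  induction x using QuotientGroup.induction_on with
  | H s => exact hw _ s.2

theorem cosetMap_injective {S : Subgroup G} (L : Subgroup S) :
    Function.Injective (cosetMap L) := by
  intro x y h
  induction x using QuotientGroup.induction_on with
  | H s =>
    induction y using QuotientGroup.induction_on with
    | H t =>
      have h' : (s : G)⁻¹ * (t : G) ∈ L.map S.subtype := QuotientGroup.eq.mp h
      obtain ⟨l, hl, hl'⟩ := h'
      refine QuotientGroup.eq.mpr ?_
      have : s⁻¹ * t = l := Subtype.ext hl'.symm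
      rwa [this]

instance (S : Subgroup G) : (inclusion 𝔉 S).Faithful where
  map_injective {L L'} t t' h := by
    refine orbitHom_ext ?_
    apply cosetMap_injective
    have := congrArg (fun k => toMap k (QuotientGroup.mk (1 : G))) h
    have e : ∀ t : L ⟶ L', toMap ((inclusion 𝔉 S).map t) (QuotientGroup.mk (1 : G)) =
        cosetMap L'.grp (toMap t (QuotientGroup.mk (1 : S))) := fun t => one_smul _ _
    exact (e t).symm.trans (this.trans (e t'))

/-- Each `G`-map `φ : G ⧸ H → W` whose image meets the orbit of `w` has an initial factorization
through the maps `G ⧸ L → W`, `g L ↦ g w`, with `L` in the family of the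
stabilizer of `w`. -/
theorem exists_initial_factorization {S : Subgroup G} (w : W) (hS : ∀ s, s ∈ S ↔ s • w = w)
    {A : OrbitCat 𝔉} (φ : (G ⧸ A.grp) →[G] W)
    (hφ : φ (QuotientGroup.mk (1 : G)) ∈ MulAction.orbit G w) :
    ∃ (L : OrbitCat (𝔉.inter S))
      (f : A ⟶ (inclusion 𝔉 S).obj L),
      (proj w (fun s => (hS s).1) L).comp (toMap f) = φ ∧
      ∀ (L' : OrbitCat (𝔉.inter S))
        (f' : A ⟶ (inclusion 𝔉 S).obj L'),
        (proj w (fun s => (hS s).1) L').comp (toMap f') = φ →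
          ∃! t : L ⟶ L', f ≫ (inclusion 𝔉 S).map t = f' := by
  obtain ⟨g, hg⟩ := hφ
  replace hg : g • w = φ (QuotientGroup.mk (1 : G)) := hg
  have hfix : ∀ x ∈ A.grp, g⁻¹ * x * g ∈ S := by
    intro x hx
    have := smul_map_one φ x hx
    rw [← hg] at this
    rw [hS, mul_smul, mul_smul, this, inv_smul_smul]
  -- `L` is the conjugate of `A.grp` by `g⁻¹`; it fixes `w`, so it lies in `S`. The map `f`, `x A ↦
  -- x g L`, is then a bijection of orbits.
  let L : OrbitCat (𝔉.inter S) :=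
    ⟨(A.grp.map (MulAut.conj g⁻¹).toMonoidHom).subgroupOf S, _, 𝔉.conj_mem _ A.mem g⁻¹, rfl⟩
  have hL : ∀ l : S, l ∈ L.grp → g * l * g⁻¹ ∈ A.grp := by
    rintro l ⟨x, hx, hxl⟩
    have : (l : G) = g⁻¹ * x * g := by simpa using hxl.symm
    rw [this]
    simpa [mul_assoc] using hx
  have hL' : ∀ x (hx : x ∈ A.grp), (⟨g⁻¹ * x * g, hfix x hx⟩ : S) ∈ L.grp :=
    fun x hx => ⟨x, hx, by simp⟩
  let f : A ⟶ (inclusion 𝔉 S).obj L :=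
    orbitMap A.grp (QuotientGroup.mk g : G ⧸ ((inclusion 𝔉 S).obj L).grp) (by
      intro x hx
      symm
      refine QuotientGroup.eq.mpr ⟨_, hL' x hx, ?_⟩
      simp [mul_assoc])
  refine ⟨L, f, orbitHom_ext ?_, ?_⟩
  · change proj w (fun s => (hS s).1) L ((1 : G) • (QuotientGroup.mk g)) = _
    rw [one_smul]
    exact hg
  intro L' f' hf'
  obtain ⟨g', hg'⟩ := QuotientGroup.mk_surjective (toMap f' (QuotientGroup.mk (1 : G)))
  have hgg : g' • w = g • w := by
    rw [hg, ← hf']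
    change _ = proj w (fun s => (hS s).1) L' (toMap f' (QuotientGroup.mk (1 : G)))
    rw [← hg']
    rfl
  -- Both `g` and `g'` carry `w` to the same point, so they differ by an element of `S`; the coset
  -- of this element determines `t`.
  let s : S := ⟨g⁻¹ * g', by
    rw [hS, mul_smul, hgg, inv_smul_smul]⟩
  have hs : ∀ l ∈ L.grp, l • (QuotientGroup.mk s : S ⧸ L'.grp) = QuotientGroup.mk s := by
    intro l hl
    have h1 := smul_map_one (toMap f') _ (hL l hl)
    rw [← hg'] at h1
    obtain ⟨k, hk, hk'⟩ : g'⁻¹ * (g * l * g⁻¹ * g') ∈ L'.grp.map S.subtype :=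
      QuotientGroup.eq.mp h1.symm
    symm
    refine QuotientGroup.eq.mpr ?_
    have : s⁻¹ * (l • s) = k := by
      refine Subtype.ext ?_
      rw [show (k : G) = _ from hk']
      simp [s, mul_assoc]
    rwa [this]
  let t : L ⟶ L' := orbitMap L.grp (QuotientGroup.mk s : S ⧸ L'.grp) hs
  have ht : f ≫ (inclusion 𝔉 S).map t = f' := by
    refine orbitHom_ext ?_
    change toMap ((inclusion 𝔉 S).map t) ((1 : G) • (QuotientGroup.mk g)) =
      toMap f' (QuotientGroup.mk (1 : G))
    rw [one_smul, ← hg', map_mk_eq_smul]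
    change g • (1 : G) • cosetMap L'.grp ((1 : S) • (QuotientGroup.mk s)) = _
    rw [one_smul, one_smul]
    exact congrArg QuotientGroup.mk (mul_inv_cancel_left g g')
  refine ⟨t, ht, fun t' ht' => ?_⟩
  -- Uniqueness: `f` is surjective and the inclusion functor is faithful.
  apply (inclusion 𝔉 S).map_injective
  refine MulActionHom.ext fun x => ?_
  obtain ⟨y, rfl⟩ : ∃ y, toMap f y = x := by
    induction x using QuotientGroup.induction_on with
    | H z =>
      refine ⟨QuotientGroup.mk (z * g⁻¹), ?_⟩
      change (z * g⁻¹) • (QuotientGroup.mk g : G ⧸ ((inclusion 𝔉 S).obj L).grp) = _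
      exact congrArg QuotientGroup.mk (inv_mul_cancel_right z g)
  exact congrArg (fun k => toMap k y) (ht'.trans ht.symm)

end OrbitCat

/-! ### Coinduced modules, and preservation of injectives by restriction to stabilizers. -/

namespace BredonMod

open OrbitCat Opposite

variable {G : Type u} [Group G] {𝔉 : SubgroupFamily G}

/-- The Bredon module `G ⧸ K ↦ ∏_H ∏_{G ⧸ H → G ⧸ K} D H`, the product of the modules coinduced from
the abelian groups `D H`. -/
def coind (D : OrbitCat 𝔉 → AddCommGrpCat.{u}) : BredonMod 𝔉 where
  obj K := AddCommGrpCat.of (∀ H : OrbitCat 𝔉, (H ⟶ K.unop) → D H)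
  map k := AddCommGrpCat.ofHom (AddMonoidHom.mk' (fun x H f => x H (f ≫ k.unop)) fun _ _ => rfl)
  map_id K := by
    ext x H f
    exact congrArg (x H) (Category.comp_id f)
  map_comp k l := by
    ext x H f
    exact congrArg (x H) (Category.assoc f _ _).symm

/-- The homomorphism from `M` to a coinduced module that belongs to homomorphisms `M H → D H`. -/
def toCoind (M : BredonMod 𝔉) (D : OrbitCat 𝔉 → AddCommGrpCat.{u})
    (j : ∀ H, M.obj (op H) ⟶ D H) : M ⟶ coind D where
  app K := AddCommGrpCat.ofHom (AddMonoidHom.mk' (fun m H f => j H (M.map f.op m))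
    (fun x y => by funext H f; simp))
  naturality K K' k := by
    ext m
    funext H f
    change j H (M.map f.op (M.map k m)) = j H (M.map (f ≫ k.unop).op m)
    rw [op_comp, M.map_comp]
    rfl

instance (M : BredonMod 𝔉) (D : OrbitCat 𝔉 → AddCommGrpCat.{u})
    (j : ∀ H, M.obj (op H) ⟶ D H) [∀ H, Mono (j H)] : Mono (toCoind M D j) := by
  have : ∀ K, Mono ((toCoind M D j).app K) := by
    intro K
    rw [AddCommGrpCat.mono_iff_injective]
    intro x y h
    have h1 : j K.unop (M.map (𝟙 K) x) = j K.unop (M.map (𝟙 K) y) :=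
      congrFun (congrFun h K.unop) (𝟙 K.unop)
    rw [M.map_id] at h1
    exact (AddCommGrpCat.mono_iff_injective (j K.unop)).1 inferInstance h1
  exact NatTrans.mono_of_mono_app _

/-- By initial factorization, the `G`-maps `G ⧸ H → G ⧸ L` are the disjoint union, over the `G`-maps
`φ : G ⧸ H → W` into the orbit of `w`, of the `S`-maps `S ⧸ L₀ H φ → S ⧸ L`. So the restricted
module is a product of modules coinduced from the injective groups `D H` at the objects `L₀ H φ`,
and a map into it extends as soon as its components `A (L₀ H φ) → D H` do. -/
theorem injective_res_coind {W : Type v} [MulAction G W] {S : Subgroup G} (w : W)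
    (hS : ∀ s, s ∈ S ↔ s • w = w) (D : OrbitCat 𝔉 → AddCommGrpCat.{u}) [∀ H, Injective (D H)] :
    Injective ((coind D).res S) := by
  classical
  let π := fun L : OrbitCat (𝔉.inter S) => proj w (fun s => (hS s).1) L
  have hπ : ∀ {H : OrbitCat 𝔉} {L : OrbitCat (𝔉.inter S)} (f : H ⟶ (inclusion 𝔉 S).obj L),
      (π L).comp (toMap f) (QuotientGroup.mk (1 : G)) ∈ MulAction.orbit G w := by
    intro H L f
    change π L (toMap f _) ∈ _
    generalize toMap f _ = x
    induction x using QuotientGroup.induction_on with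
    | H g => exact ⟨g, rfl⟩
  choose L₀ f₀ hf₀ hu using fun (H : OrbitCat 𝔉) (φ : {φ : (G ⧸ H.grp) →[G] W //
    φ (QuotientGroup.mk (1 : G)) ∈ MulAction.orbit G w}) =>
      exists_initial_factorization (𝔉 := 𝔉) w hS φ.1 φ.2
  choose t ht htu using hu
  refine ⟨fun {A B} g i hi => ?_⟩
  let α : ∀ H φ, A.obj (op (L₀ H φ)) ⟶ D H := fun H φ =>
    AddCommGrpCat.ofHom (AddMonoidHom.mk' (fun a =>
      (g.app _ a : ∀ K : OrbitCat 𝔉, (K ⟶ (inclusion 𝔉 S).obj (L₀ H φ)) → D K) H (f₀ H φ))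
      (fun x y => by rw [map_add]; rfl))
  let β : ∀ H φ, B.obj (op (L₀ H φ)) ⟶ D H := fun H φ =>
    Injective.factorThru (α H φ) (i.app _)
  have hβ : ∀ H φ a, β H φ (i.app _ a) =
      (g.app _ a : ∀ K : OrbitCat 𝔉, (K ⟶ (inclusion 𝔉 S).obj (L₀ H φ)) → D K) H (f₀ H φ) := by
    intro H φ a
    have := Injective.comp_factorThru (α H φ) (i.app _)
    exact congrArg (fun k => k a) this
  let ext : ∀ (L : OrbitCat (𝔉.inter S)) (b : B.obj (op L)) (H : OrbitCat 𝔉)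
      (f : H ⟶ (inclusion 𝔉 S).obj L), D H := fun L b H f =>
    β H ⟨_, hπ f⟩ (B.map (t H ⟨_, hπ f⟩ L f rfl).op b)
  -- Stated for any `φ` equal to the composite: naturality compares `f` with `f ≫ k`, whose
  -- projections to `W` agree only by `proj_comp`.
  have hext : ∀ (L : OrbitCat (𝔉.inter S)) (b : B.obj (op L)) (H : OrbitCat 𝔉)
      (f : H ⟶ (inclusion 𝔉 S).obj L) φ (h : (π L).comp (toMap f) = φ.1),
      ext L b H f = β H φ (B.map (t H φ L f h).op b) := by
    rintro L b H f ⟨φ, hφ⟩ h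
    change (π L).comp (toMap f) = φ at h
    subst h
    rfl
  let h : B ⟶ (coind D).res S :=
    { app := fun L => AddCommGrpCat.ofHom (AddMonoidHom.mk' (ext L.unop)
        (fun x y => by funext H f; simp [ext]))
      naturality := by
        intro L L' k
        ext b
        funext H f
        have h1 : (π L.unop).comp (toMap (f ≫ (inclusion 𝔉 S).map k.unop)) =
            (π L'.unop).comp (toMap f) :=
          congrArg (fun ψ => MulActionHom.comp ψ (toMap f))
            (proj_comp w (fun s => (hS s).1) k.unop)
        refine (hext L'.unop (B.map k b) H f ⟨_, hπ f⟩ rfl).trans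
          (Eq.trans ?_ (hext L.unop b H (f ≫ (inclusion 𝔉 S).map k.unop) ⟨_, hπ f⟩ h1).symm)
        -- Naturality of the extension is the uniqueness of the map out of the initial
        -- factorization.
        have h2 := htu H ⟨_, hπ f⟩ L.unop (f ≫ (inclusion 𝔉 S).map k.unop) h1
          (t H ⟨_, hπ f⟩ L'.unop f rfl ≫ k.unop) (by
            change _ ≫ (inclusion 𝔉 S).map _ = _
            rw [Functor.map_comp, ← Category.assoc]
            exact congrArg (· ≫ _) (ht H ⟨_, hπ f⟩ L'.unop f rfl))
        rw [← h2, op_comp, B.map_comp]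
        rfl }
  refine ⟨h, ?_⟩
  ext L a
  funext H f
  change ext L.unop (i.app L a) H f = _
  rw [hext L.unop (i.app L a) H f ⟨_, hπ f⟩ rfl]
  have h1 : B.map (t H ⟨_, hπ f⟩ L.unop f rfl).op (i.app L a) =
      i.app _ (A.map (t H ⟨_, hπ f⟩ L.unop f rfl).op a) :=
    (congrArg (fun k => k a) (i.naturality (t H ⟨_, hπ f⟩ L.unop f rfl).op)).symm
  rw [h1, hβ]
  have h2 : g.app _ (A.map (t H ⟨_, hπ f⟩ L.unop f rfl).op a) =
      ((coind D).res S).map (t H ⟨_, hπ f⟩ L.unop f rfl).op (g.app L a) :=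
    congrArg (fun k => k a) (g.naturality (t H ⟨_, hπ f⟩ L.unop f rfl).op)
  rw [h2]
  change (g.app L a : ∀ K : OrbitCat 𝔉, (K ⟶ (inclusion 𝔉 S).obj L.unop) → D K) H
    (f₀ H ⟨_, hπ f⟩ ≫ (inclusion 𝔉 S).map (t H ⟨_, hπ f⟩ L.unop f rfl)) = _
  exact congrArg _ (ht H ⟨_, hπ f⟩ L.unop f rfl)

/-- Restriction to a subgroup as a functor. -/
abbrev resFunctor (𝔉 : SubgroupFamily G) (S : Subgroup G) :
    BredonMod 𝔉 ⥤ BredonMod (𝔉.inter S) :=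
  (Functor.whiskeringLeft _ _ _).obj (inclusion 𝔉 S).op

/-- The product of the modules coinduced from the injective hulls of the values of `M`. -/
noncomputable abbrev coindHull (M : BredonMod 𝔉) : BredonMod 𝔉 :=
  coind fun H => Injective.under (M.obj (op H))

/-- The embedding of a Bredon module into a coinduced module. -/
noncomputable abbrev toCoindHull (M : BredonMod 𝔉) : M ⟶ coindHull M :=
  toCoind M _ fun H => Injective.ι (M.obj (op H))

/-- An injective module is a retract of its coinduced hull, and functors preserve retracts. -/
theorem preservesInjectiveObjects_resFunctor {W : Type v} [MulAction G W] {S : Subgroup G} (w : W)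
    (hS : ∀ s, s ∈ S ↔ s • w = w) : (resFunctor 𝔉 S).PreservesInjectiveObjects where
  injective_obj {I} hI := by
    have : Injective ((resFunctor 𝔉 S).obj (coindHull I)) := injective_res_coind w hS _
    have r : Retract I (coindHull I) :=
      { i := toCoindHull I
        r := Injective.factorThru (𝟙 I) (toCoindHull I)
        retract := Injective.comp_factorThru _ _ }
    exact (r.map (resFunctor 𝔉 S)).injective

end BredonMod

/-! ### Homomorphisms from `ℤ` as compatible families, and natural families over a `G`-set. -/

namespace BredonMod

open OrbitCat Opposite

section hom

variable {G : Type u} [Group G] {𝔉 : SubgroupFamily G} {M N : BredonMod 𝔉}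

/-- The value at `G ⧸ A` of the section of `M` that corresponds to `s : ℤ ⟶ M`. -/
def homEval (s : trivial 𝔉 ⟶ M) (A : OrbitCat 𝔉) : M.obj (op A) :=
  s.app (op A) (ULift.up (1 : ℤ) : ULift.{u} ℤ)

theorem map_homEval (s : trivial 𝔉 ⟶ M) {A B : OrbitCat 𝔉} (f : A ⟶ B) :
    M.map f.op (homEval s B) = homEval s A :=
  (congrArg (fun k => k (ULift.up (1 : ℤ) : ULift.{u} ℤ)) (s.naturality f.op)).symm

theorem hom_ext_of_homEval {s s' : trivial 𝔉 ⟶ M} (h : ∀ A, homEval s A = homEval s' A) :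
    s = s' := by
  ext A n
  have hn : ∀ t : trivial 𝔉 ⟶ M, t.app A n = n.down • homEval t A.unop := by
    intro t
    refine Eq.trans (congrArg (t.app A) ?_)
      (map_zsmul (t.app A).hom n.down (ULift.up (1 : ℤ) : ULift.{u} ℤ))
    exact ULift.ext _ _ (mul_one n.down).symm
  exact (hn s).trans ((congrArg (n.down • ·) (h A.unop)).trans (hn s').symm)

/-- The homomorphism `ℤ ⟶ M` that belongs to a compatible family of elements. -/
def homMk (x : ∀ A : OrbitCat 𝔉, M.obj (op A))
    (hx : ∀ {A B : OrbitCat 𝔉} (f : A ⟶ B), M.map f.op (x B) = x A) : trivial 𝔉 ⟶ M where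
  app A := AddCommGrpCat.ofHom
    ((zmultiplesHom (M.obj A) (x A.unop)).comp AddEquiv.ulift.toAddMonoidHom)
  naturality A B f := by
    ext n
    change n.down • x B.unop = M.map f (n.down • x A.unop)
    rw [map_zsmul]
    exact congrArg _ (hx f.unop).symm

@[simp]
theorem homEval_homMk (x : ∀ A : OrbitCat 𝔉, M.obj (op A))
    (hx : ∀ {A B : OrbitCat 𝔉} (f : A ⟶ B), M.map f.op (x B) = x A) (A : OrbitCat 𝔉) :
    homEval (homMk x hx) A = x A :=
  one_zsmul (x A)

end hom

section res

variable {G : Type u} [Group G] {𝔉 : SubgroupFamily G} {S : Subgroup G} {M N : BredonMod 𝔉}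

/-- The values of a section over `S` of the restriction of `M`, as elements of values of `M`. -/
def resEval (n : trivial (𝔉.inter S) ⟶ M.res S) (L : OrbitCat (𝔉.inter S)) :
    M.obj (op ((inclusion 𝔉 S).obj L)) :=
  homEval n L

theorem map_resEval (n : trivial (𝔉.inter S) ⟶ M.res S) {L L' : OrbitCat (𝔉.inter S)}
    (t : L ⟶ L') : M.map ((inclusion 𝔉 S).map t).op (resEval n L') = resEval n L :=
  map_homEval n t

theorem resEval_add (n n' : trivial (𝔉.inter S) ⟶ M.res S) (L : OrbitCat (𝔉.inter S)) :
    resEval (n + n') L = resEval n L + resEval n' L := rfl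

/-- The restriction of a homomorphism of Bredon modules. -/
def resMap (S : Subgroup G) (θ : M ⟶ N) : M.res S ⟶ N.res S := (resFunctor 𝔉 S).map θ

theorem resEval_comp (n : trivial (𝔉.inter S) ⟶ M.res S) (θ : M ⟶ N)
    (L : OrbitCat (𝔉.inter S)) : resEval (n ≫ resMap S θ) L =
      θ.app (op ((inclusion 𝔉 S).obj L)) (resEval n L) := rfl

theorem hom_ext_of_resEval {n n' : trivial (𝔉.inter S) ⟶ M.res S}
    (h : ∀ L, resEval n L = resEval n' L) : n = n' :=
  hom_ext_of_homEval h

/-- The section over `S` that belongs to a compatible family of elements of values of `M`. -/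
def resMk (x : ∀ L : OrbitCat (𝔉.inter S), M.obj (op ((inclusion 𝔉 S).obj L)))
    (hx : ∀ {L L' : OrbitCat (𝔉.inter S)} (t : L ⟶ L'),
      M.map ((inclusion 𝔉 S).map t).op (x L') = x L) : trivial (𝔉.inter S) ⟶ M.res S :=
  homMk (M := M.res S) x hx

@[simp]
theorem resEval_resMk (x : ∀ L : OrbitCat (𝔉.inter S), M.obj (op ((inclusion 𝔉 S).obj L)))
    (hx : ∀ {L L' : OrbitCat (𝔉.inter S)} (t : L ⟶ L'),
      M.map ((inclusion 𝔉 S).map t).op (x L') = x L) (L : OrbitCat (𝔉.inter S)) :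
    resEval (resMk x hx) L = x L :=
  homEval_homMk (M := M.res S) x hx L

end res

section sections

variable {G : Type u} [Group G] {𝔉 : SubgroupFamily G} {M N : BredonMod 𝔉}
  {W : Type v} [MulAction G W]

/-- The natural families of elements `m φ ∈ M (G ⧸ A)`, for all `G`-maps `φ : G ⧸ A → W`. -/
def equivariantSections (W : Type v) [MulAction G W] (M : BredonMod 𝔉) :
    AddSubgroup (∀ A : OrbitCat 𝔉, ((G ⧸ A.grp) →[G] W) → M.obj (op A)) where
  carrier := {m | ∀ (A B : OrbitCat 𝔉) (f : A ⟶ B) (φ : (G ⧸ B.grp) →[G] W),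
    M.map f.op (m B φ) = m A (φ.comp (toMap f))}
  add_mem' {m m'} hm hm' A B f φ := by
    change M.map f.op (m B φ + m' B φ) = m A _ + m' A _
    rw [map_add, hm, hm']
  zero_mem' A B f φ := map_zero _
  neg_mem' {m} hm A B f φ := by
    change M.map f.op (- m B φ) = - m A _
    rw [map_neg, hm]

theorem map_section (m : equivariantSections W M) {A B : OrbitCat 𝔉} (f : A ⟶ B)
    (φ : (G ⧸ B.grp) →[G] W) : M.map f.op (m.1 B φ) = m.1 A (φ.comp (toMap f)) := m.2 A B f φ

/-- Postcomposition of natural families with a homomorphism of Bredon modules. -/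
def mapSections (W : Type v) [MulAction G W] (θ : M ⟶ N) :
    equivariantSections W M →+ equivariantSections W N :=
  AddMonoidHom.mk' (fun m => ⟨fun A φ => θ.app (op A) (m.1 A φ), fun A B f φ => by
    exact (congrArg (fun k => k (m.1 B φ)) (θ.naturality f.op)).symm.trans
      (congrArg (θ.app (op A)) (m.2 A B f φ))⟩)
    (fun m m' => Subtype.ext (by funext A φ; exact map_add _ _ _))

theorem map_section_proj {S : Subgroup G} (w : W) (hw : ∀ s ∈ S, s • w = w)
    (m : equivariantSections W M) {L L' : OrbitCat (𝔉.inter S)} (t : L ⟶ L') :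
    M.map ((inclusion 𝔉 S).map t).op (m.1 ((inclusion 𝔉 S).obj L') (proj w hw L')) =
      m.1 ((inclusion 𝔉 S).obj L) (proj w hw L) :=
  (map_section m _ _).trans (congrArg (m.1 _) (proj_comp w hw t))

/-- Restriction of a natural family to the orbit of a point `w`, as a section over a subgroup `S`
that fixes `w`. -/
def evalAt {S : Subgroup G} (w : W) (hw : ∀ s ∈ S, s • w = w) (M : BredonMod 𝔉) :
    equivariantSections W M →+ (trivial (𝔉.inter S) ⟶ M.res S) :=
  AddMonoidHom.mk' (fun m => resMk (fun L => m.1 ((inclusion 𝔉 S).obj L) (proj w hw L))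
      (map_section_proj w hw m))
    (fun m m' => hom_ext_of_resEval fun L => by
      rw [resEval_add, resEval_resMk, resEval_resMk, resEval_resMk]
      rfl)

theorem resEval_evalAt {S : Subgroup G} (w : W) (hw : ∀ s ∈ S, s • w = w)
    (m : equivariantSections W M) (L : OrbitCat (𝔉.inter S)) :
    resEval (evalAt w hw M m) L = m.1 ((inclusion 𝔉 S).obj L) (proj w hw L) :=
  resEval_resMk _ (map_section_proj w hw m) L

theorem evalAt_mapSections {S : Subgroup G} (w : W) (hw : ∀ s ∈ S, s • w = w) (θ : M ⟶ N)
    (m : equivariantSections W M) :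
    evalAt w hw N (mapSections W θ m) = evalAt w hw M m ≫ resMap S θ := by
  refine hom_ext_of_resEval fun L => ?_
  rw [resEval_evalAt, resEval_comp, resEval_evalAt]
  rfl

/-- Since `φ` factors through some `proj`, the value at `φ` is pulled back from a value that
`evalAt` records. -/
theorem section_eq_of_evalAt_eq {S : Subgroup G} (w : W) (hS : ∀ s, s ∈ S ↔ s • w = w)
    {m m' : equivariantSections W M}
    (h : evalAt w (fun s => (hS s).1) M m = evalAt w (fun s => (hS s).1) M m')
    {A : OrbitCat 𝔉} (φ : (G ⧸ A.grp) →[G] W)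
    (hφ : φ (QuotientGroup.mk (1 : G)) ∈ MulAction.orbit G w) : m.1 A φ = m'.1 A φ := by
  obtain ⟨L, f, hf, -⟩ := exists_initial_factorization w hS φ hφ
  have hL := congrArg (fun s => resEval s L) h
  simp only [resEval_evalAt] at hL
  rw [← hf, ← map_section, ← map_section, hL]

/-- The value at `φ` has to be the pullback of `n` along the initial factorization of `φ`;
initiality makes this choice natural. -/
theorem exists_section_on_orbit {S : Subgroup G} (w : W) (hS : ∀ s, s ∈ S ↔ s • w = w)
    (n : trivial (𝔉.inter S) ⟶ M.res S) :
    ∃ m : ∀ (A : OrbitCat 𝔉) (φ : (G ⧸ A.grp) →[G] W),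
        φ (QuotientGroup.mk (1 : G)) ∈ MulAction.orbit G w → M.obj (op A),
      (∀ (A B : OrbitCat 𝔉) (f : A ⟶ B) (φ : (G ⧸ B.grp) →[G] W) (hφ)
        (hφ' : (φ.comp (toMap f)) (QuotientGroup.mk (1 : G)) ∈ MulAction.orbit G w),
        M.map f.op (m B φ hφ) = m A (φ.comp (toMap f)) hφ') ∧
      ∀ (L : OrbitCat (𝔉.inter S)) (h), m ((inclusion 𝔉 S).obj L) (proj w (fun s => (hS s).1) L) h =
        resEval n L := by
  choose L₀ f₀ hf₀ hu using fun (A : OrbitCat 𝔉) (φ : (G ⧸ A.grp) →[G] W) hφ =>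
    exists_initial_factorization (𝔉 := 𝔉) w hS φ hφ
  have hn : ∀ {L L' : OrbitCat (𝔉.inter S)} (t : L ⟶ L'),
      M.map ((inclusion 𝔉 S).map t).op (resEval n L') = resEval n L := fun t => map_resEval n t
  refine ⟨fun A φ hφ => M.map (f₀ A φ hφ).op (resEval n (L₀ A φ hφ)), ?_, ?_⟩
  · intro A B f φ hφ hφ'
    obtain ⟨t, ht, -⟩ := hu A (φ.comp (toMap f)) hφ' (L₀ B φ hφ) (f ≫ f₀ B φ hφ)
      (congrArg (fun ψ => MulActionHom.comp ψ (toMap f)) (hf₀ B φ hφ))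
    have h2 := congrArg (fun k => M.map (Quiver.Hom.op k) (resEval n (L₀ B φ hφ))) ht
    simp only [op_comp, M.map_comp] at h2
    change M.map f.op (M.map (f₀ B φ hφ).op (resEval n (L₀ B φ hφ))) =
      M.map (f₀ A (φ.comp (toMap f)) hφ').op (resEval n _)
    rw [← hn t]
    exact h2.symm
  · intro L h
    obtain ⟨t, ht, -⟩ := hu _ _ h L (𝟙 _) rfl
    have h1 := congrArg (fun k => M.map (Quiver.Hom.op k) (resEval n L)) ht
    simp only [op_comp, M.map_comp, op_id, M.map_id] at h1
    change M.map (f₀ _ _ h).op (resEval n _) = _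
    rw [← hn t]
    exact h1

/-- Distinct representatives have disjoint orbits, so the families on the orbits glue. The set `A₀`
need not be all of `W`: for edges, `W` is `Sym2 V`, which also contains pairs that are not edges. -/
theorem exists_section {A₀ R : Set W} (hR : IsOrbitReps G A₀ R)
    (n : ∀ w : R, trivial (𝔉.inter (MulAction.stabilizer G (w : W))) ⟶ M.res _) :
    ∃ m : equivariantSections W M, ∀ w : R,
      evalAt (w : W) (fun _ => MulAction.mem_stabilizer_iff.1) M m = n w := by
  classical
  choose μ hμ hμ' using fun w : R => exists_section_on_orbit (w : W)
    (fun _ => MulAction.mem_stabilizer_iff) (n w)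
  -- The value 0 off the orbits of `R` is harmless: precomposition does not change the orbit that a
  -- map hits, so naturality never mixes the two cases.
  let m : ∀ A : OrbitCat 𝔉, ((G ⧸ A.grp) →[G] W) → M.obj (op A) := fun A φ =>
    if h : ∃ w : R, φ (QuotientGroup.mk (1 : G)) ∈ MulAction.orbit G (w : W) then
      μ h.choose A φ h.choose_spec else 0
  have hm : ∀ (A : OrbitCat 𝔉) (φ : (G ⧸ A.grp) →[G] W) (w : R)
      (h : φ (QuotientGroup.mk (1 : G)) ∈ MulAction.orbit G (w : W)), m A φ = μ w A φ h := by
    intro A φ w h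
    have hex : ∃ w : R, φ (QuotientGroup.mk (1 : G)) ∈ MulAction.orbit G (w : W) := ⟨w, h⟩
    have key : ∀ (w' : R) (h' : φ (QuotientGroup.mk (1 : G)) ∈ MulAction.orbit G (w' : W)),
        μ w' A φ h' = μ w A φ h := by
      intro w' h'
      have : w' = w := by
        refine Subtype.ext ((hR.2 w' (hR.1 w'.2)).unique
          ⟨w'.2, MulAction.mem_orbit_self _⟩ ⟨w.2, ?_⟩)
        rw [← MulAction.orbit_eq_iff.2 h', MulAction.mem_orbit_symm]
        exact h
      subst this
      rfl
    simp only [m, dif_pos hex]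
    exact key _ _
  have horb : ∀ {A B : OrbitCat 𝔉} (f : A ⟶ B) (φ : (G ⧸ B.grp) →[G] W) (w : W),
      (φ.comp (toMap f)) (QuotientGroup.mk (1 : G)) ∈ MulAction.orbit G w ↔
        φ (QuotientGroup.mk (1 : G)) ∈ MulAction.orbit G w := by
    intro A B f φ w
    change φ (toMap f _) ∈ _ ↔ _
    generalize toMap f _ = x
    induction x using QuotientGroup.induction_on with
    | H g =>
      rw [map_mk_eq_smul, MulAction.mem_orbit_symm, MulAction.mem_orbit_symm (a₂ := w)]
      exact ⟨fun h => by
        rwa [MulAction.orbit_eq_iff.2 (MulAction.mem_orbit _ g)] at h, fun h => by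
        rwa [MulAction.orbit_eq_iff.2 (MulAction.mem_orbit _ g)]⟩
  refine ⟨⟨m, ?_⟩, fun w => hom_ext_of_resEval fun L => ?_⟩
  · intro A B f φ
    by_cases h : ∃ w : R, φ (QuotientGroup.mk (1 : G)) ∈ MulAction.orbit G (w : W)
    · obtain ⟨w, hw⟩ := h
      rw [hm B φ w hw, hm A _ w ((horb f φ w).2 hw)]
      exact hμ w A B f φ hw _
    · have h' : ¬ ∃ w : R, (φ.comp (toMap f)) (QuotientGroup.mk (1 : G)) ∈
          MulAction.orbit G (w : W) := fun ⟨w, hw⟩ => h ⟨w, (horb f φ w).1 hw⟩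
      simp only [m, dif_neg h, dif_neg h', map_zero]
  · rw [resEval_evalAt]
    have h1 : proj (w : W) (fun _ => MulAction.mem_stabilizer_iff.1) L (QuotientGroup.mk (1 : G)) ∈
        MulAction.orbit G (w : W) := ⟨1, rfl⟩
    exact (hm _ _ w h1).trans (hμ' w L h1)

/-- Natural families over `W` are determined by their restrictions to representatives of the
orbits of `W`. -/
noncomputable def sectionsEquiv {R : Set W} (hR : IsOrbitReps G Set.univ R) (M : BredonMod 𝔉) :
    equivariantSections W M ≃+
      ∀ w : R, trivial (𝔉.inter (MulAction.stabilizer G (w : W))) ⟶ M.res _ :=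
  AddEquiv.ofBijective
    (AddMonoidHom.pi fun w : R => evalAt (w : W) (fun _ => MulAction.mem_stabilizer_iff.1) M)
    ⟨fun m m' h => Subtype.ext (by
      funext A φ
      obtain ⟨w, ⟨hw, hφ⟩, -⟩ := hR.2 (φ (QuotientGroup.mk (1 : G))) (Set.mem_univ _)
      rw [MulAction.mem_orbit_symm] at hφ
      exact section_eq_of_evalAt_eq w (fun _ => MulAction.mem_stabilizer_iff)
        (congrFun h ⟨w, hw⟩) φ hφ),
    fun n => by
      obtain ⟨m, hm⟩ := exists_section hR n
      exact ⟨m, funext hm⟩⟩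

end sections

end BredonMod

/-! ### The augmented cochain sequence of the tree and its exactness. -/

namespace BredonMod

open OrbitCat Opposite

variable {G : Type u} [Group G] {𝔉 : SubgroupFamily G} {V : Type v} [MulAction G V]
  {X : SimpleGraph V} {M N : BredonMod 𝔉}

theorem smul_sym2 (g : G) (a b : V) : g • s(a, b) = s(g • a, g • b) := rfl

/-- An element that stabilizes an edge fixes or swaps its ends, and a swap is an inversion. -/
theorem stabilizer_fixes (hX : IsGTree G X) {a b : V} (h : X.Adj a b) {e : Sym2 V}
    (he : s(a, b) = e) (g : G) (hg : g ∈ MulAction.stabilizer G e) : g • a = a ∧ g • b = b := by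
  subst he
  rw [MulAction.mem_stabilizer_iff, smul_sym2, Sym2.eq_iff] at hg
  exact hg.resolve_right (hX.no_inversion g a b h)

theorem proj_sym2 {a b : V} {e : Sym2 V} (he : s(a, b) = e) {S : Subgroup G}
    (ha : ∀ s ∈ S, s • a = a) (hb : ∀ s ∈ S, s • b = b) (hS : ∀ s ∈ S, s • e = e)
    (L : OrbitCat (𝔉.inter S)) (x : G ⧸ ((inclusion 𝔉 S).obj L).grp) :
    s(proj a ha L x, proj b hb L x) = proj e hS L x := by
  subst he
  induction x using QuotientGroup.induction_on with
  | H g => rfl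

/-- The natural family over `V` that is constant on each fixed point set. -/
def constSections (V : Type v) [MulAction G V] (M : BredonMod 𝔉) :
    (trivial 𝔉 ⟶ M) →+ equivariantSections V M :=
  AddMonoidHom.mk' (fun s => ⟨fun A _ => homEval s A, fun _ _ f _ => map_homEval s f⟩)
    (fun _ _ => rfl)

theorem constSections_comp (s : trivial 𝔉 ⟶ M) (θ : M ⟶ N) :
    constSections V N (s ≫ θ) = mapSections V θ (constSections V M s) := rfl

/-- The coboundary of a natural family over the vertices, on representatives of the edges. -/
def coboundary (hX : IsGTree G X) {R₁ : Set (Sym2 V)} {a b : R₁ → V}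
    (hab : ∀ e, X.Adj (a e) (b e)) (he : ∀ e, s(a e, b e) = (e : Sym2 V)) (M : BredonMod 𝔉) :
    equivariantSections V M →+
      ∀ e : R₁, trivial (𝔉.inter (MulAction.stabilizer G (e : Sym2 V))) ⟶ M.res _ :=
  AddMonoidHom.pi fun e =>
    evalAt (b e) (fun g hg => (stabilizer_fixes hX (hab e) (he e) g hg).2) M -
      evalAt (a e) (fun g hg => (stabilizer_fixes hX (hab e) (he e) g hg).1) M

/-- Translates of oriented representatives orient each edge in exactly one direction. -/
theorem orientation_swap (hX : IsGTree G X) {R₁ : Set (Sym2 V)} {a b : R₁ → V}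
    (hab : ∀ e, X.Adj (a e) (b e)) (he : ∀ e, s(a e, b e) = (e : Sym2 V))
    (hR₁ : IsOrbitReps G X.edgeSet R₁) {w w' : V} (h : X.Adj w w') :
    (∃ (e : R₁) (g : G), g • a e = w' ∧ g • b e = w) ↔
      ¬ ∃ (e : R₁) (g : G), g • a e = w ∧ g • b e = w' := by
  constructor
  · rintro ⟨e, g, h1, h2⟩ ⟨e', g', h1', h2'⟩
    have h3 : g • (e : Sym2 V) = s(w, w') := by
      rw [← he, smul_sym2, h1, h2, Sym2.eq_swap]
    have h4 : g' • (e' : Sym2 V) = s(w, w') := by rw [← he, smul_sym2, h1', h2']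
    have hee : e = e' := by
      refine Subtype.ext ((hR₁.2 s(w, w') h).unique ⟨e.2, ?_⟩ ⟨e'.2, ?_⟩)
      · rw [MulAction.mem_orbit_symm]; exact ⟨g, h3⟩
      · rw [MulAction.mem_orbit_symm]; exact ⟨g', h4⟩
    subst hee
    -- If an edge were oriented both ways, `g'⁻¹ * g` would swap the ends of its representative.
    refine hX.no_inversion (g'⁻¹ * g) _ _ (hab e) ⟨?_, ?_⟩
    · rw [mul_smul, h1, ← h2', inv_smul_smul]
    · rw [mul_smul, h2, ← h1', inv_smul_smul]
  · intro hn
    obtain ⟨e, ⟨heR, horb⟩, -⟩ := hR₁.2 s(w, w') h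
    rw [MulAction.mem_orbit_symm] at horb
    obtain ⟨g, hg⟩ := horb
    have hg' : s(g • a ⟨e, heR⟩, g • b ⟨e, heR⟩) = s(w, w') := by
      rw [← smul_sym2, he]
      exact hg
    rcases Sym2.eq_iff.1 hg' with hg | hg
    · exact absurd ⟨_, _, hg⟩ hn
    · exact ⟨_, _, hg⟩

section exact

variable (hX : IsGTree G X) {R₁ : Set (Sym2 V)} {a b : R₁ → V}
  (hab : ∀ e, X.Adj (a e) (b e)) (he : ∀ e, s(a e, b e) = (e : Sym2 V))

theorem resEval_coboundary (m : equivariantSections V M) (e : R₁)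
    (L : OrbitCat (𝔉.inter (MulAction.stabilizer G (e : Sym2 V)))) :
    resEval (coboundary hX hab he M m e) L =
      m.1 ((inclusion 𝔉 _).obj L)
        (proj (b e) (fun g hg => (stabilizer_fixes hX (hab e) (he e) g hg).2) L) -
      m.1 ((inclusion 𝔉 _).obj L)
        (proj (a e) (fun g hg => (stabilizer_fixes hX (hab e) (he e) g hg).1) L) := by
  rw [← resEval_evalAt, ← resEval_evalAt]
  rfl

theorem coboundary_mapSections (θ : M ⟶ N) (m : equivariantSections V M) (e : R₁) :
    coboundary hX hab he N (mapSections V θ m) e = coboundary hX hab he M m e ≫ resMap _ θ := by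
  change evalAt _ _ N (mapSections V θ m) - evalAt _ _ N (mapSections V θ m) =
    (evalAt _ _ M m - evalAt _ _ M m) ≫ resMap _ θ
  rw [Preadditive.sub_comp, evalAt_mapSections, evalAt_mapSections]

/-- As `X^A` has a vertex, the value at `A` can be read off there. -/
theorem constSections_injective (hfix : ∀ F ∈ 𝔉, (fixedSubgraph X F).Connected) :
    Function.Injective (constSections V M) := by
  intro s s' h
  refine hom_ext_of_homEval fun A => ?_
  obtain ⟨w⟩ := (hfix A.grp A.mem).nonempty
  exact congrFun (congrFun (congrArg Subtype.val h) A)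
    (orbitMap A.grp (w : V) fun x hx => w.2 ⟨x, hx⟩)

theorem coboundary_constSections (s : trivial 𝔉 ⟶ M) :
    coboundary hX hab he M (constSections V M s) = 0 := by
  funext e
  refine hom_ext_of_resEval fun L => ?_
  rw [resEval_coboundary]
  exact sub_self _

/-- Each edge fixed by `A` comes from one of the representatives. -/
theorem exists_edge_factorization (hR₁ : IsOrbitReps G X.edgeSet R₁) {A : OrbitCat 𝔉}
    (φ ψ : (G ⧸ A.grp) →[G] V)
    (h : X.Adj (φ (QuotientGroup.mk (1 : G))) (ψ (QuotientGroup.mk (1 : G)))) :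
    ∃ (e : R₁) (L : OrbitCat (𝔉.inter (MulAction.stabilizer G (e : Sym2 V))))
      (f : A ⟶ (inclusion 𝔉 _).obj L),
      let α := (proj (a e)
        (fun g hg => (stabilizer_fixes hX (hab e) (he e) g hg).1) L).comp (toMap f)
      let β := (proj (b e)
        (fun g hg => (stabilizer_fixes hX (hab e) (he e) g hg).2) L).comp (toMap f)
      (φ = α ∧ ψ = β) ∨ (φ = β ∧ ψ = α) := by
  -- The edge as an unordered pair is again an orbit map, so it factors through its representative;
  -- the order of the ends is recovered only up to a swap.
  let χ : (G ⧸ A.grp) →[G] Sym2 V := orbitMap A.grp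
    s(φ (QuotientGroup.mk (1 : G)), ψ (QuotientGroup.mk (1 : G))) (fun x hx => by
      rw [smul_sym2, smul_map_one φ x hx, smul_map_one ψ x hx])
  have hχ : χ (QuotientGroup.mk (1 : G)) =
      s(φ (QuotientGroup.mk (1 : G)), ψ (QuotientGroup.mk (1 : G))) := one_smul G _
  obtain ⟨e, ⟨heR, horb⟩, -⟩ := hR₁.2 _ ((SimpleGraph.mem_edgeSet X).2 h)
  rw [← hχ, MulAction.mem_orbit_symm] at horb
  obtain ⟨L, f, hf, -⟩ := exists_initial_factorization e
    (fun _ => MulAction.mem_stabilizer_iff) χ horb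
  refine ⟨⟨e, heR⟩, L, f, ?_⟩
  intro α β
  have key : s(α (QuotientGroup.mk (1 : G)), β (QuotientGroup.mk (1 : G))) =
      s(φ (QuotientGroup.mk (1 : G)), ψ (QuotientGroup.mk (1 : G))) := by
    rw [← hχ, ← hf]
    exact proj_sym2 (he ⟨e, heR⟩)
      (fun g hg => (stabilizer_fixes hX (hab _) (he ⟨e, heR⟩) g hg).1)
      (fun g hg => (stabilizer_fixes hX (hab _) (he ⟨e, heR⟩) g hg).2)
      (fun _ => MulAction.mem_stabilizer_iff.1) L _
  rcases Sym2.eq_iff.1 key with ⟨h1, h2⟩ | ⟨h1, h2⟩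
  · exact Or.inl ⟨orbitHom_ext h1.symm, orbitHom_ext h2.symm⟩
  · exact Or.inr ⟨orbitHom_ext h2.symm, orbitHom_ext h1.symm⟩

/-- A family with zero coboundary agrees at the two ends of each edge of `X^A`, because that edge is
a translate of a representative. Connectedness of `X^A` then makes it constant. -/
theorem exists_constSections_eq (hfix : ∀ F ∈ 𝔉, (fixedSubgraph X F).Connected)
    (hR₁ : IsOrbitReps G X.edgeSet R₁) (m : equivariantSections V M)
    (hm : coboundary hX hab he M m = 0) : ∃ s, constSections V M s = m := by
  have hadj : ∀ (A : OrbitCat 𝔉) (φ ψ : (G ⧸ A.grp) →[G] V),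
      X.Adj (φ (QuotientGroup.mk (1 : G))) (ψ (QuotientGroup.mk (1 : G))) →
        m.1 A φ = m.1 A ψ := by
    intro A φ ψ h
    obtain ⟨e, L, f, h'⟩ := exists_edge_factorization hX hab he hR₁ φ ψ h
    have h0 := resEval_coboundary hX hab he m e L
    rw [hm] at h0
    have h1 := congrArg (M.map f.op) (sub_eq_zero.1 h0.symm)
    rw [map_section, map_section] at h1
    rcases h' with ⟨rfl, rfl⟩ | ⟨rfl, rfl⟩
    · exact h1.symm
    · exact h1
  let pt : ∀ (A : OrbitCat 𝔉) (w : MulAction.fixedPoints A.grp V), (G ⧸ A.grp) →[G] V :=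
    fun A w => orbitMap A.grp (w : V) fun x hx => w.2 ⟨x, hx⟩
  have hpt : ∀ A w, pt A w (QuotientGroup.mk (1 : G)) = w := fun A w => one_smul G (w : V)
  have hreach : ∀ (A : OrbitCat 𝔉) (w w' : MulAction.fixedPoints A.grp V),
      m.1 A (pt A w) = m.1 A (pt A w') := by
    intro A w w'
    obtain ⟨p⟩ := (hfix A.grp A.mem).preconnected w w'
    induction p with
    | nil => rfl
    | cons h _ ih =>
      refine (hadj A _ _ ?_).trans ih
      rw [hpt, hpt]
      exact h
  have hconst : ∀ (A : OrbitCat 𝔉) (φ ψ : (G ⧸ A.grp) →[G] V), m.1 A φ = m.1 A ψ := by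
    intro A φ ψ
    have hφ : ∀ φ : (G ⧸ A.grp) →[G] V, φ = pt A ⟨φ (QuotientGroup.mk (1 : G)),
        fun x => smul_map_one φ _ x.2⟩ := fun φ => orbitHom_ext
        (hpt A ⟨φ (QuotientGroup.mk (1 : G)), fun x => smul_map_one φ _ x.2⟩).symm
    rw [hφ φ, hφ ψ]
    exact hreach A _ _
  let w := fun A : OrbitCat 𝔉 => (hfix A.grp A.mem).nonempty.some
  refine ⟨homMk (fun A => m.1 A (pt A (w A))) (fun {A B} f => ?_), ?_⟩
  · rw [map_section]
    exact hconst A _ _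
  · refine Subtype.ext ?_
    funext A φ
    exact (homEval_homMk _ _ A).trans (hconst A _ _)

/-- A natural family over `V` with values in `coind D` amounts to one arbitrary function `V^H → D H`
for each `H`, and likewise for edges. The problem thus splits into one potential problem on each
tree `X^H`. -/
theorem coboundary_surjective_coind (hfix : ∀ F ∈ 𝔉, (fixedSubgraph X F).Connected)
    (hR₁ : IsOrbitReps G X.edgeSet R₁) (D : OrbitCat 𝔉 → AddCommGrpCat.{u}) :
    Function.Surjective (coboundary hX hab he (coind D)) := by
  intro n
  obtain ⟨c, hc⟩ := exists_section hR₁ n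
  let val : ∀ (K : OrbitCat 𝔉), (coind D).obj (op K) → ∀ H : OrbitCat 𝔉, (H ⟶ K) → D H :=
    fun K x => x
  let ed : ∀ (H : OrbitCat 𝔉) (w w' : MulAction.fixedPoints H.grp V), (G ⧸ H.grp) →[G] Sym2 V :=
    fun H w w' => orbitMap H.grp s((w : V), (w' : V)) fun x hx => by
      rw [smul_sym2]
      exact congrArg₂ _ (w.2 ⟨x, hx⟩) (w'.2 ⟨x, hx⟩)
  have hed : ∀ H w w', ed H w w' = ed H w' w := by
    intro H w w'
    refine orbitHom_ext ?_
    change (1 : G) • s((w : V), (w' : V)) = (1 : G) • s((w' : V), (w : V))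
    rw [Sym2.eq_swap]
  -- The edges of `X^H` are oriented as translates of `(a e, b e)`. The coordinate at `𝟙 H`
  -- suffices, since naturality recovers the coordinate at every `f : H ⟶ K` from it.
  choose p hp using fun H : OrbitCat 𝔉 =>
    SimpleGraph.IsTree.exists_potential_of_orientation (X := fixedSubgraph X H.grp)
      ⟨hfix H.grp H.mem, hX.isTree.isAcyclic.induce _⟩
      (fun w w' => ∃ (e : R₁) (g : G), g • a e = w ∧ g • b e = w')
      (fun w w' h => orientation_swap hX hab he hR₁ h)
      (fun w w' => val H (c.1 H (ed H w w')) H (𝟙 H)) (fun w w' => by rw [hed])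
  let fx : ∀ {H : OrbitCat 𝔉} (_ : (G ⧸ H.grp) →[G] V), MulAction.fixedPoints H.grp V :=
    fun φ => ⟨φ (QuotientGroup.mk (1 : G)), fun x => smul_map_one φ _ x.2⟩
  refine ⟨⟨fun K φ => (fun H f => p H (fx (φ.comp (toMap f))) :
    ∀ H : OrbitCat 𝔉, (H ⟶ K) → D H), fun A B f φ => rfl⟩, ?_⟩
  funext e
  rw [← hc e]
  refine hom_ext_of_resEval fun L => ?_
  rw [resEval_coboundary, resEval_evalAt]
  funext H f
  have ha := fun g hg => (stabilizer_fixes hX (hab e) (he e) g hg).1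
  have hb := fun g hg => (stabilizer_fixes hX (hab e) (he e) g hg).2
  let α := (proj (a e) ha L).comp (toMap f)
  let β := (proj (b e) hb L).comp (toMap f)
  change p H (fx β) - p H (fx α) = val _ (c.1 _ _) H f
  obtain ⟨g, hg⟩ := QuotientGroup.mk_surjective (toMap f (QuotientGroup.mk (1 : G)))
  have hα : (fx α : V) = g • a e := by
    change proj (a e) ha L (toMap f (QuotientGroup.mk (1 : G))) = _
    rw [← hg]; rfl
  have hβ : (fx β : V) = g • b e := by
    change proj (b e) hb L (toMap f (QuotientGroup.mk (1 : G))) = _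
    rw [← hg]; rfl
  have hadj : (fixedSubgraph X H.grp).Adj (fx α) (fx β) := by
    change X.Adj (fx α : V) (fx β : V)
    rw [hα, hβ]
    exact hX.smul_adj g _ _ (hab e)
  rw [hp H (fx α) (fx β) hadj ⟨e, g, hα.symm, hβ.symm⟩]
  have h1 := map_section c f (proj (e : Sym2 V) (fun _ => MulAction.mem_stabilizer_iff.1) L)
  have h2 : ed H (fx α) (fx β) =
      (proj (e : Sym2 V) (fun _ => MulAction.mem_stabilizer_iff.1) L).comp (toMap f) := by
    refine orbitHom_ext ?_
    change (1 : G) • s((fx α : V), (fx β : V)) =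
      proj (e : Sym2 V) (fun _ => MulAction.mem_stabilizer_iff.1) L
        (toMap f (QuotientGroup.mk (1 : G)))
    rw [hα, hβ, one_smul, ← smul_sym2, he, ← hg]
    rfl
  rw [h2, ← h1]
  exact congrArg (val _ (c.1 _ _) H) (Category.id_comp f)

/-- The coboundary is natural in the module, so surjectivity passes from the coinduced hull to its
retract `I`. -/
theorem coboundary_surjective (hfix : ∀ F ∈ 𝔉, (fixedSubgraph X F).Connected)
    (hR₁ : IsOrbitReps G X.edgeSet R₁) (I : BredonMod 𝔉) [Injective I] :
    Function.Surjective (coboundary hX hab he I) := by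
  intro n
  obtain ⟨m, hm⟩ := coboundary_surjective_coind hX hab he hfix hR₁
    (fun H => Injective.under (I.obj (op H))) (fun e => n e ≫ resMap _ (toCoindHull I))
  let r : coindHull I ⟶ I := Injective.factorThru (𝟙 I) (toCoindHull I)
  have hr : toCoindHull I ≫ r = 𝟙 I := Injective.comp_factorThru _ _
  refine ⟨mapSections V r m, ?_⟩
  funext e
  rw [coboundary_mapSections, hm, Category.assoc]
  have : ∀ S : Subgroup G, resMap S (toCoindHull I) ≫ resMap S r = 𝟙 (I.res S) := by
    intro S
    refine ((resFunctor 𝔉 S).map_comp _ _).symm.trans ?_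
    rw [hr]
    exact (resFunctor 𝔉 S).map_id I
  rw [this, Category.comp_id]

end exact

end BredonMod

/-! ### The short exact sequence of complexes and the resulting long exact sequence. -/

namespace BredonMod

open OrbitCat

variable {G : Type u} [Group G] {𝔉 : SubgroupFamily G}

theorem enoughInjectives (𝔉 : SubgroupFamily G) : EnoughInjectives (BredonMod 𝔉) :=
  haveI : HasSeparator (BredonMod 𝔉) := Presheaf.hasSeparator.{u} _ _
  haveI : IsGrothendieckAbelian.{u} (BredonMod 𝔉) :=
    { ab5OfSize := ⟨fun _ _ _ => inferInstance⟩ }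
  inferInstance

theorem resMap_comp {M N P : BredonMod 𝔉} (S : Subgroup G) (θ : M ⟶ N) (η : N ⟶ P) :
    resMap S (θ ≫ η) = resMap S θ ≫ resMap S η := rfl

theorem resMap_zero {M N : BredonMod 𝔉} (S : Subgroup G) :
    resMap S (0 : M ⟶ N) = 0 := rfl

instance (S : Subgroup G) : (resFunctor 𝔉 S).Additive where

instance (S : Subgroup G) : (resFunctor 𝔉 S).PreservesHomology := inferInstance

/-- The differential of the complex of sections over `S` of the restriction of a resolution. -/
def resDifferential {M : BredonMod 𝔉} (I : InjectiveResolution M) (S : Subgroup G) (n : ℕ) :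
    (trivial (𝔉.inter S) ⟶ (I.cocomplex.X n).res S) →+
      (trivial (𝔉.inter S) ⟶ (I.cocomplex.X (n + 1)).res S) :=
  Preadditive.rightComp _ (resMap S (I.cocomplex.d n (n + 1)))

/-- The Bredon cohomology of the stabilizer of a point is computed by the restriction of an
injective resolution. -/
noncomputable def resPresentation {M : BredonMod 𝔉} (I : InjectiveResolution M) {W : Type v}
    [MulAction G W] {S : Subgroup G} (w : W) (hS : ∀ s, s ∈ S ↔ s • w = w) :
    CohomologyPresentation
      (fun n => trivial (𝔉.inter S) ⟶ (I.cocomplex.X n).res S) (resDifferential I S)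
      (fun n => BredonCohomology (𝔉.inter S) (M.res S) n) :=
  haveI := preservesInjectiveObjects_resFunctor (𝔉 := 𝔉) w hS
  (I.map (resFunctor 𝔉 S)).extPresentation (trivial (𝔉.inter S))

/-- The long exact sequence in Bredon cohomology of an action on a tree, for a choice of an
orientation of the representatives of the edges. -/
theorem exists_long_exact_of_orientation {V : Type v} [MulAction G V] {X : SimpleGraph V}
    (hX : IsGTree G X) (hfix : ∀ F ∈ 𝔉, (fixedSubgraph X F).Connected)
    {R₀ : Set V} (hR₀ : IsOrbitReps G Set.univ R₀)
    {R₁ : Set (Sym2 V)} (hR₁ : IsOrbitReps G X.edgeSet R₁) {a b : R₁ → V}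
    (hab : ∀ e, X.Adj (a e) (b e)) (he : ∀ e, s(a e, b e) = (e : Sym2 V)) (M : BredonMod 𝔉) :
    ∃ (α : ∀ i : ℕ, BredonCohomology 𝔉 M i →+
          ∀ v : R₀, BredonCohomology (𝔉.inter (MulAction.stabilizer G (v : V))) (M.res _) i)
      (β : ∀ i : ℕ,
          (∀ v : R₀, BredonCohomology (𝔉.inter (MulAction.stabilizer G (v : V))) (M.res _) i) →+
          ∀ e : R₁, BredonCohomology (𝔉.inter (MulAction.stabilizer G (e : Sym2 V))) (M.res _) i)
      (δ : ∀ i : ℕ,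
          (∀ e : R₁, BredonCohomology (𝔉.inter (MulAction.stabilizer G (e : Sym2 V)))
            (M.res _) i) →+ BredonCohomology 𝔉 M (i + 1)),
      Function.Injective (α 0) ∧
      ∀ i : ℕ, Function.Exact (α i) (β i) ∧ Function.Exact (β i) (δ i) ∧
        Function.Exact (δ i) (α (i + 1)) := by
  have : EnoughInjectives (BredonMod 𝔉) := enoughInjectives 𝔉
  let I : InjectiveResolution M := injectiveResolution M
  refine CohomologyPresentation.exists_long_exact
    (I.extPresentation (BredonMod.trivial 𝔉))
    (CohomologyPresentation.pi fun v : R₀ => resPresentation I (v : V)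
      (fun _ => MulAction.mem_stabilizer_iff))
    (CohomologyPresentation.pi fun e : R₁ => resPresentation I (e : Sym2 V)
      (fun _ => MulAction.mem_stabilizer_iff))
    ?_
    -- The middle complex is the product over vertex representatives; `sectionsEquiv` translates it
    -- into natural families over `V`, where exactness was shown.
    (fun n => (sectionsEquiv hR₀ (I.cocomplex.X n)).toAddMonoidHom.comp
      (constSections V (I.cocomplex.X n))) ?_
    (fun n => (coboundary hX hab he (I.cocomplex.X n)).comp
      (sectionsEquiv hR₀ (I.cocomplex.X n)).symm.toAddMonoidHom) ?_ ?_ ?_ ?_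
  · intro n x
    funext v
    change (x v ≫ resMap _ (I.cocomplex.d n (n + 1))) ≫ resMap _ (I.cocomplex.d (n + 1) (n + 2)) = 0
    rw [Category.assoc, ← resMap_comp, I.cocomplex.d_comp_d, resMap_zero, Limits.comp_zero]
  · intro n s
    funext v
    change evalAt _ _ _ (constSections V _ s) ≫ resMap _ (I.cocomplex.d n (n + 1)) =
      evalAt _ _ _ (constSections V _ (s ≫ I.cocomplex.d n (n + 1)))
    rw [constSections_comp, evalAt_mapSections]
  · intro n x
    obtain ⟨m, rfl⟩ := (sectionsEquiv hR₀ (I.cocomplex.X n)).surjective x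
    have h1 : CohomologyPresentation.piDifferential (fun v : R₀ => resDifferential I _)
        n (sectionsEquiv hR₀ (I.cocomplex.X n) m) =
        sectionsEquiv hR₀ (I.cocomplex.X (n + 1)) (mapSections V (I.cocomplex.d n (n + 1)) m) := by
      funext v
      exact (evalAt_mapSections _ _ _ m).symm
    funext e
    change coboundary hX hab he _ ((sectionsEquiv hR₀ _).symm (sectionsEquiv hR₀ _ m)) e ≫
      resMap _ (I.cocomplex.d n (n + 1)) = coboundary hX hab he _ ((sectionsEquiv hR₀ _).symm _) e
    rw [h1, AddEquiv.symm_apply_apply, AddEquiv.symm_apply_apply, coboundary_mapSections]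
  · intro n
    exact (sectionsEquiv hR₀ _).injective.comp (constSections_injective hfix)
  · intro n x
    obtain ⟨m, rfl⟩ := (sectionsEquiv hR₀ (I.cocomplex.X n)).surjective x
    change coboundary hX hab he _ ((sectionsEquiv hR₀ _).symm (sectionsEquiv hR₀ _ m)) = 0 ↔ _
    rw [AddEquiv.symm_apply_apply]
    constructor
    · intro h
      obtain ⟨s, rfl⟩ := exists_constSections_eq hX hab he hfix hR₁ m h
      exact ⟨s, rfl⟩
    · rintro ⟨s, hs⟩
      rw [← (sectionsEquiv hR₀ _).injective hs]
      exact coboundary_constSections hX hab he s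
  · intro n
    -- Of the three exactness conditions, only this one uses that the terms of the resolution are
    -- injective.
    exact (coboundary_surjective hX hab he hfix hR₁ _).comp (sectionsEquiv hR₀ _).symm.surjective

end BredonMod

theorem corollary4p6 {G : Type u} [Group G] (𝔉 : SubgroupFamily G)
    {V : Type v} [MulAction G V] (X : SimpleGraph V) (hX : IsGTree G X)
    (hfix : ∀ F ∈ 𝔉, (fixedSubgraph X F).Connected)
    (R₀ : Set V) (hR₀ : IsOrbitReps G Set.univ R₀)
    (R₁ : Set (Sym2 V)) (hR₁ : IsOrbitReps G X.edgeSet R₁)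
    (M : BredonMod 𝔉) :
    ∃ (α : ∀ i : ℕ, BredonCohomology 𝔉 M i →+
          ∀ v : R₀, BredonCohomology (𝔉.inter (MulAction.stabilizer G (v : V))) (M.res _) i)
      (β : ∀ i : ℕ,
          (∀ v : R₀, BredonCohomology (𝔉.inter (MulAction.stabilizer G (v : V))) (M.res _) i) →+
          ∀ e : R₁, BredonCohomology (𝔉.inter (MulAction.stabilizer G (e : Sym2 V))) (M.res _) i)
      (δ : ∀ i : ℕ,
          (∀ e : R₁, BredonCohomology (𝔉.inter (MulAction.stabilizer G (e : Sym2 V)))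
            (M.res _) i) →+ BredonCohomology 𝔉 M (i + 1)),
      Function.Injective (α 0) ∧
      ∀ i : ℕ, Function.Exact (α i) (β i) ∧ Function.Exact (β i) (δ i) ∧
        Function.Exact (δ i) (α (i + 1)) := by
  -- Any orientation of the edge representatives will do.
  obtain ⟨a, b, hab, he⟩ : ∃ a b : R₁ → V, (∀ e, X.Adj (a e) (b e)) ∧
      ∀ e, s(a e, b e) = (e : Sym2 V) := by
    have : ∀ e : R₁, ∃ a b : V, X.Adj a b ∧ s(a, b) = (e : Sym2 V) := by
      rintro ⟨e, he⟩
      have he' := hR₁.1 he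
      induction e using Sym2.ind with
      | _ a b => exact ⟨a, b, he', rfl⟩
    choose a b h using this
    exact ⟨a, b, fun e => (h e).1, fun e => (h e).2⟩
  exact BredonMod.exists_long_exact_of_orientation hX hfix hR₀ hR₁ hab he M
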